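/- Let $\varepsilon_1=\varepsilon_3=1$, $\varepsilon_2=-1$. Lamé's system of first order with the Guichard condition, for functions $l_i$ ($1\le i\le 3$) and $h_{ij}$ ($1\le i\ne j\le 3$) of $x=(x_1,x_2,x_3)\in\mathbb R^3$, consists of the following equations, for all distinct $i,j,k\in\{1,2,3\}$: \begin{align*} &\text{(A)}\quad \varepsilon_i l_i^2+\varepsilon_j l_j^2+\varepsilon_k l_k^2=0, & &\text{(B)}\quad l_{i,x_j}-h_{ij}l_j=0,\\ &\text{(C)}\quad \varepsilon_i l_{i,x_i}+\varepsilon_j h_{ji}l_j+\varepsilon_k h_{ki}l_k=0, & &\text{(D)}\quad h_{ij,x_k}-h_{ik}h_{kj}=0,\\ &\text{(E)}\quad h_{ij,x_j}+h_{ji,x_i}+h_{ik}h_{jk}=0, & &\text{(F)}\quad \varepsilon_i h_{ij,x_i}+\varepsilon_j h_{ji,x_j}+\varepsilon_k h_{ki}h_{kj}=0. \end{align*} Let $M$ be an open subset of the space $\mathbb R^{3}\times\mathbb R^{3}\times\mathbb R^{6}$ of the variables $(x,l,h)$, and let $\Sigma=\{(x,l,h): l_1^2-l_2^2+l_3^2=0\}$;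 assume that $M\cap\Sigma$ is connected (or empty). Let $$V=\sum_i \xi^i(x,l,h)\frac{\partial}{\partial x_i}+\sum_i\eta^i(x,l,h)\frac{\partial}{\partial l_i}+\sum_{i\neq j}\phi^{ij}(x,l,h)\frac{\partial}{\partial h_{ij}}$$ be a $C^\infty$ vector field on $M$ that is an infinitesimal generator of the Lie point symmetry group of the system, i.e. it satisfies the infinitesimal criterion: $\mathrm{pr}^{(1)}V[\Delta]=0$ for every equation $\Delta=0$ of (A)–(F), at every point of the first jet space over $M$ at which all the equations (A)–(F) hold. Here the first prolongation of a vector field $\sum_i\xi^i\,\partial/\partial x_i+\sum_\alpha\varphi_\alpha\,\partial/\partial u^\alpha$ in the variables $x$ and $u=(l,h)$ has the coefficients $D_k\varphi_\alpha-\sum_r (D_k\xi^r)\,u^\alpha_{,x_r}$ at $\partial/\partial u^\alpha_{,x_k}$, with the total derivatives $D_k=\partial/\partial x_k+\sum_\alpha u^\alpha_{,x_k}\,\partial/\partial u^\alpha$. Then there are real constants $a,c,a_1,a_2,a_3$ such that, at all points of $M$ that satisfy the Guichard condition (A), $$\xi^i=a x_i+a_i,\qquad \eta^i=c\,l_i,\qquad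 \phi^{ij}=-a\,h_{ij}\quad(i\ne j).$$ -/

import Mathlib

open scoped ContDiff

/-! ### First-order jets and point symmetries of a first-order system -/

/-- The space `X × U` of independent variables `x = (x_i)` and dependent variables `u = (u^α)`. -/
abbrev BaseSpace (ι κ : Type) : Type := (ι → ℝ) × (κ → ℝ)

/-- The first jet space `X × U⁽¹⁾`: a point `(x, u, p)`, where `p α i` is the coordinate of the
derivative of `u^α` with respect to `x_i`. -/
abbrev JetSpace (ι κ : Type) : Type := (ι → ℝ) × (κ → ℝ) × (κ → ι → ℝ)

/-- The projection of the jet space to `X × U`. -/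
def JetSpace.base {ι κ : Type} (z : JetSpace ι κ) : BaseSpace ι κ := (z.1, z.2.1)

/-- A vector field `∑ ξ^i(x,u) ∂/∂x_i + ∑ φ_α(x,u) ∂/∂u^α` on `X × U`. -/
structure PointField (ι κ : Type) where
  ξ : BaseSpace ι κ → ι → ℝ
  φ : BaseSpace ι κ → κ → ℝ

section Prolongation

variable {ι κ : Type} [Fintype ι] [Fintype κ] [DecidableEq ι]

/-- The total derivative `D_i f = ∂f/∂x_i + ∑_α u^α_i ∂f/∂u^α` of a function `f(x,u)`,
as a function on the first jet space. -/
noncomputable def totalDeriv (i : ι) (f : BaseSpace ι κ → ℝ) (z : JetSpace ι κ) : ℝ :=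
  fderiv ℝ f z.base (Pi.single i 1, fun α => z.2.2 α i)

/-- The coefficient `φ_α^i = D_i φ_α - ∑_r D_i(ξ^r) u^α_r` of `∂/∂u^α_i` in the first
prolongation of `V`. -/
noncomputable def PointField.prolongCoeff (V : PointField ι κ) (α : κ) (i : ι)
    (z : JetSpace ι κ) : ℝ :=
  totalDeriv i (fun y => V.φ y α) z
    - ∑ r, totalDeriv i (fun y => V.ξ y r) z * z.2.2 α r

/-- The first prolongation of `V`, a vector field on the first jet space. -/
noncomputable def PointField.prolong (V : PointField ι κ) (z : JetSpace ι κ) : JetSpace ι κ :=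
  (V.ξ z.base, V.φ z.base, fun α i => V.prolongCoeff α i z)

/-- `V` is a (smooth) infinitesimal generator, over the open set `M ⊆ X × U`, of the Lie point
symmetry group of the first-order system `Δ = 0`, `Δ ∈ S`: the derivative of every equation of
the system along the first prolongation of `V` vanishes at every jet over `M` that satisfies all
equations of the system. -/
structure IsInfinitesimalGenerator (S : Set (JetSpace ι κ → ℝ)) (M : Set (BaseSpace ι κ))
    (V : PointField ι κ) : Prop where
  smooth_ξ : ContDiffOn ℝ ∞ V.ξ M
  smooth_φ : ContDiffOn ℝ ∞ V.φ M
  criterion : ∀ z : JetSpace ι κ, z.base ∈ M → (∀ Δ ∈ S, Δ z = 0) →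
    ∀ Δ ∈ S, fderiv ℝ Δ z (V.prolong z) = 0

end Prolongation

/-! ### Lamé's system of first order with the Guichard condition -/

namespace Lame

/-- The index set of the dependent variables: `l_i` for `i` in `{1,2,3}` (here `Fin 3`), and
`h_{ij}` for `i ≠ j`. -/
abbrev Dep : Type := Fin 3 ⊕ {s : Fin 3 × Fin 3 // s.1 ≠ s.2}

/-- The index of the variable `l_i`. -/
abbrev lIdx (i : Fin 3) : Dep := Sum.inl i

/-- The index of the variable `h_{ij}`, `i ≠ j`. -/
abbrev hIdx (i j : Fin 3) (hij : i ≠ j) : Dep := Sum.inr ⟨(i, j), hij⟩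

/-- The signs `ε₁ = 1`, `ε₂ = -1`, `ε₃ = 1`. -/
def ε : Fin 3 → ℝ := ![1, -1, 1]

abbrev Base : Type := BaseSpace (Fin 3) Dep
abbrev Jet : Type := JetSpace (Fin 3) Dep

/-- The jet coordinate `l_i`. -/
def l (i : Fin 3) (z : Jet) : ℝ := z.2.1 (lIdx i)

/-- The jet coordinate `h_{ij}`. -/
def h (i j : Fin 3) (hij : i ≠ j) (z : Jet) : ℝ := z.2.1 (hIdx i j hij)

/-- The jet coordinate `l_{i,x_k}`. -/
def dl (i k : Fin 3) (z : Jet) : ℝ := z.2.2 (lIdx i) k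

/-- The jet coordinate `h_{ij,x_k}`. -/
def dh (i j : Fin 3) (hij : i ≠ j) (k : Fin 3) (z : Jet) : ℝ := z.2.2 (hIdx i j hij) k

/-- The left-hand sides of the equations of Lamé's system of first order, for all
distinct `i, j, k`. -/
inductive IsEquation : (Jet → ℝ) → Prop
  | A (i j k : Fin 3) (hij : i ≠ j) (hik : i ≠ k) (hjk : j ≠ k) :
      IsEquation fun z => ε i * l i z ^ 2 + ε j * l j z ^ 2 + ε k * l k z ^ 2
  | B (i j : Fin 3) (hij : i ≠ j) :
      IsEquation fun z => dl i j z - h i j hij z * l j z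
  | C (i j k : Fin 3) (hij : i ≠ j) (hik : i ≠ k) (hjk : j ≠ k) :
      IsEquation fun z =>
        ε i * dl i i z + ε j * h j i hij.symm z * l j z + ε k * h k i hik.symm z * l k z
  | D (i j k : Fin 3) (hij : i ≠ j) (hik : i ≠ k) (hjk : j ≠ k) :
      IsEquation fun z => dh i j hij k z - h i k hik z * h k j hjk.symm z
  | E (i j k : Fin 3) (hij : i ≠ j) (hik : i ≠ k) (hjk : j ≠ k) :
      IsEquation fun z =>
        dh i j hij j z + dh j i hij.symm i z + h i k hik z * h j k hjk z
  | F (i j k : Fin 3) (hij : i ≠ j) (hik : i ≠ k) (hjk : j ≠ k) :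
      IsEquation fun z =>
        ε i * dh i j hij i z + ε j * dh j i hij.symm j z
          + ε k * h k i hik.symm z * h k j hjk.symm z

/-- Lamé's system of first order. -/
def system : Set (Jet → ℝ) := {Δ | IsEquation Δ}

/-- The set of all `(x, l, h)` that satisfy the Guichard condition `l₁² - l₂² + l₃² = 0`. -/
def guichardSet : Set Base := {y | ∑ i, ε i * y.2 (lIdx i) ^ 2 = 0}

end Lame

/-!
Over a point of the Guichard cone `∑ ε_i l_i² = 0`, the solution jets of Lamé's system form an affine
space with six free parameters, two for each pair `{i, j}` of indices: the derivatives of `h_{ij}`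
and `h_{ji}` with respect to `x_i` and `x_j` satisfy only two equations (`solJet`, `solVec_eq`). The
infinitesimal criterion is polynomial in these parameters, and comparing coefficients gives linear
equations for the derivatives of `ξ`, `η`, `φ` at the points of the cone.

* The equations for `h_{ij,k}` give `D_k ξ^i = 0` for `i ≠ k` (`fderiv_xi_solVec`). Therefore `ξ^i`
  has no derivative along the cone except `∂ξ^i/∂x_i`. The equations for `h_{ij,j} + h_{ji,i}` and
  `ε_i h_{ij,i} + ε_j h_{ji,j}` show that these derivatives agree for all `i`, and that
  `c_{ij} = ∂φ^{ij}/∂h_{ij}` is symmetric (`fderiv_xi_eX_and_phi_eH_symm`). Let `a` be the common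
  value of `∂ξ^i/∂x_i`.
* The equations for `h_{ij,k}`, differentiated with respect to `h`, give `c_{ij} = a + c_{ik} + c_{kj}`.
  Hence `c_{ij} = -a` and `φ^{ij} = -a h_{ij}` (`phi_eq`).
* The equations for the derivatives of `l` now say that, on the cone, `η` does not depend on `x` and
  `h`, and that it is equivariant under the infinitesimal rotations of the quadratic form
  (`fderiv_eta_rot`). By equivariance under the rotation with axis `l`, `η` is parallel to `l`
  (`lv_mul_eta`), with a factor that is constant along the cone.

Throughout, a function that vanishes on the cone may be differentiated in directions tangent to the
cone (`fderiv_eq_zero_of_isTangent`), and the symmetry of second derivatives disposes of the terms of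
second order (`hasDerivAt_fderiv_line_of_isTangent`). Finally, `a`, `ξ^i - a x_i` and the factor of `η`
are constant on the connected set `M ∩ Σ`, where `Σ` is the cone. For the first two this holds since
their derivatives along the cone vanish (`ConstAlongCone.exists_eq`). The factor of `η` is not defined
at the vertices `l = 0`, where the two halves of the cone meet; there the differentiability of `η`
implies that the factors on both halves agree (`eta_eventually_eq_of_vertex`).
-/

open Filter Topology

namespace Lame

/-! ### The jets that solve the system -/

/-- The coordinate `h_{ij}` of a point of the base, extended by `0` to `i = j`. -/
noncomputable def hv (y : Base) (i j : Fin 3) : ℝ :=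
  if hij : i ≠ j then y.2 (hIdx i j hij) else 0

lemma hv_of_ne (y : Base) {i j : Fin 3} (hij : i ≠ j) : hv y i j = y.2 (hIdx i j hij) :=
  dif_pos hij

/-- The coordinate `l_i` of a point (or the `l_i`-component of a vector) of the base. -/
def lv (y : Base) (i : Fin 3) : ℝ := y.2 (lIdx i)

/-- The derivative coordinates `u^α_k` of a jet over `y` that solves the system. The derivatives of
`l` and the derivatives `h_{ij,k}` with `k ∉ {i, j}` are determined by `y`. The remaining four
derivatives of `h_{ij}` and `h_{ji}` are subject to two equations; the two free parameters are the
entries at `(i, j)` of the antisymmetric matrices `σ` (for `h_{ij,j}`, `h_{ji,i}`) and `τ` (for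
`h_{ij,i}`, `h_{ji,j}`). As indices are taken modulo `3`, the third index besides `i ≠ j` is
`-(i + j)`. -/
noncomputable def jetCoeff (y : Base) (σ τ : Fin 3 → Fin 3 → ℝ) : Dep → Fin 3 → ℝ
  | Sum.inl i, k => if i = k then -(ε i * ∑ m, ε m * hv y m i * lv y m) else hv y i k * lv y k
  | Sum.inr s, k =>
      if k = s.1.1 then
        ε s.1.1 * (τ s.1.1 s.1.2
          - ε (-(s.1.1 + s.1.2)) * hv y (-(s.1.1 + s.1.2)) s.1.1
            * hv y (-(s.1.1 + s.1.2)) s.1.2 / 2)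
      else if k = s.1.2 then
        σ s.1.1 s.1.2 - hv y s.1.1 (-(s.1.1 + s.1.2)) * hv y s.1.2 (-(s.1.1 + s.1.2)) / 2
      else hv y s.1.1 k * hv y k s.1.2

/-- The jet over `y` with parameters `σ` and `τ`; see `solJet_mem` for the equations. -/
noncomputable def solJet (y : Base) (σ τ : Fin 3 → Fin 3 → ℝ) : Jet :=
  (y.1, y.2, jetCoeff y σ τ)

/-- The vector of the base along which the total derivative `D_k` differentiates at
`solJet y σ τ`. -/
noncomputable def solVec (y : Base) (σ τ : Fin 3 → Fin 3 → ℝ) (k : Fin 3) : Base :=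
  (Pi.single k 1, fun α => jetCoeff y σ τ α k)

lemma solJet_mem {y : Base} (hy : y ∈ guichardSet) {σ τ : Fin 3 → Fin 3 → ℝ}
    (hσ : ∀ i j, σ j i = -σ i j) (hτ : ∀ i j, τ j i = -τ i j) :
    ∀ Δ ∈ system, Δ (solJet y σ τ) = 0 := by
  have hy' : lv y 0 ^ 2 - lv y 1 ^ 2 + lv y 2 ^ 2 = 0 := by
    have := hy
    simp only [guichardSet, Set.mem_ofPred_eq, Fin.sum_univ_three, ε] at this
    simp at this
    simp only [lv]
    linarith
  have e3 : -(2 : Fin 3) = 1 := by decide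
  have e4 : -(1 : Fin 3) = 2 := by decide
  rintro Δ (⟨i, j, k, hij, hik, hjk⟩ | ⟨i, j, hij⟩ | ⟨i, j, k, hij, hik, hjk⟩ |
    ⟨i, j, k, hij, hik, hjk⟩ | ⟨i, j, k, hij, hik, hjk⟩ | ⟨i, j, k, hij, hik, hjk⟩) <;>
  fin_cases i <;> fin_cases j <;> (try fin_cases k) <;>
  first
  | exact absurd rfl hij
  | exact absurd rfl hik
  | exact absurd rfl hjk
  | (simp [l, h, dl, dh, solJet, jetCoeff, ε, hv, Fin.sum_univ_three, lv, e3, e4, hσ 0 1,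
      hσ 0 2, hσ 1 2, hτ 0 1, hτ 0 2, hτ 1 2] at hy' ⊢
     try linarith)

/-- The vector `∂/∂x_k`. -/
def eX (k : Fin 3) : Base := (Pi.single k 1, 0)

/-- The vector `∂/∂l_i`. -/
def eL (i : Fin 3) : Base := (0, Pi.single (lIdx i) 1)

/-- The vector `∂/∂h_{ij}`. -/
def eH (i j : Fin 3) (hij : i ≠ j) : Base := (0, Pi.single (hIdx i j hij) 1)

/-- The value at `y` of the infinitesimal rotation `l_k ∂/∂l_m - ε_k ε_m l_m ∂/∂l_k` of the quadratic
form `∑ ε_i l_i²`. -/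
def rot (m k : Fin 3) (y : Base) : Base :=
  lv y k • eL m - (ε k * ε m * lv y m) • eL k

set_option maxHeartbeats 2000000 in
/-- Along a solution, `l` moves by infinitesimal rotations, and each of the free parameters enters
`D_k` through exactly one of the directions `∂/∂h_{ik}`, `∂/∂h_{jk}`, `∂/∂h_{ki}`, `∂/∂h_{kj}`. -/
lemma solVec_eq (y : Base) (σ τ : Fin 3 → Fin 3 → ℝ) {i j k : Fin 3} (hij : i ≠ j) (hik : i ≠ k)
    (hjk : j ≠ k) :
    solVec y σ τ k = eX k + hv y i k • rot i k y + hv y j k • rot j k y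
      + (hv y i k * hv y k j) • eH i j hij + (hv y j k * hv y k i) • eH j i hij.symm
      + (σ i k - hv y i j * hv y k j / 2) • eH i k hik
      + (σ j k - hv y j i * hv y k i / 2) • eH j k hjk
      + (ε k * (τ k i - ε j * hv y j k * hv y j i / 2)) • eH k i hik.symm
      + (ε k * (τ k j - ε i * hv y i k * hv y i j / 2)) • eH k j hjk.symm := by
  have e3 : -(2 : Fin 3) = 1 := by decide
  have e4 : -(1 : Fin 3) = 2 := by decide
  refine Prod.ext ?_ ?_
  · simp [solVec, eX, eL, eH, rot]
  · funext α
    rcases α with m | ⟨⟨m, n⟩, hmn⟩ <;> fin_cases i <;> fin_cases j <;>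
    (first | exact absurd rfl hij | fin_cases k) <;>
    first
    | exact absurd rfl hik
    | exact absurd rfl hjk
    | (fin_cases m <;> (try fin_cases n) <;>
        first
        | exact absurd rfl hmn
        | (simp [solVec, eX, eL, eH, rot, jetCoeff, hv, lv, ε, e3, e4, Fin.sum_univ_three]
           try ring))

/-! ### The infinitesimal criterion on the solution jets -/

/-- The jet coordinate `u^α` as a continuous linear functional. -/
noncomputable def uCLM (α : Dep) : Jet →L[ℝ] ℝ :=
  (ContinuousLinearMap.proj (R := ℝ) (φ := fun _ : Dep => ℝ) α).comp
    ((ContinuousLinearMap.fst ℝ (Dep → ℝ) (Dep → Fin 3 → ℝ)).comp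
      (ContinuousLinearMap.snd ℝ (Fin 3 → ℝ) ((Dep → ℝ) × (Dep → Fin 3 → ℝ))))

/-- The jet coordinate `u^α_k` as a continuous linear functional. -/
noncomputable def pCLM (α : Dep) (k : Fin 3) : Jet →L[ℝ] ℝ :=
  (ContinuousLinearMap.proj (R := ℝ) (φ := fun _ : Fin 3 => ℝ) k).comp
    ((ContinuousLinearMap.proj (R := ℝ) (φ := fun _ : Dep => Fin 3 → ℝ) α).comp
    ((ContinuousLinearMap.snd ℝ (Dep → ℝ) (Dep → Fin 3 → ℝ)).comp
      (ContinuousLinearMap.snd ℝ (Fin 3 → ℝ) ((Dep → ℝ) × (Dep → Fin 3 → ℝ)))))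

@[simp] lemma uCLM_apply (α : Dep) (z : Jet) : uCLM α z = z.2.1 α := rfl

@[simp] lemma pCLM_apply (α : Dep) (k : Fin 3) (z : Jet) : pCLM α k z = z.2.2 α k := rfl

lemma hasFDerivAt_u (α : Dep) (z : Jet) : HasFDerivAt (fun z : Jet => z.2.1 α) (uCLM α) z :=
  (uCLM α).hasFDerivAt

lemma hasFDerivAt_p (α : Dep) (k : Fin 3) (z : Jet) :
    HasFDerivAt (fun z : Jet => z.2.2 α k) (pCLM α k) z :=
  (pCLM α k).hasFDerivAt

section
variable {M : Set Base} {V : PointField (Fin 3) Dep}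

/-- The coefficient of `∂/∂l_i`. -/
def eta (V : PointField (Fin 3) Dep) (i : Fin 3) (y : Base) : ℝ := V.φ y (lIdx i)

/-- The coefficient of `∂/∂h_{ij}`. -/
def phi (V : PointField (Fin 3) Dep) (i j : Fin 3) (hij : i ≠ j) (y : Base) : ℝ :=
  V.φ y (hIdx i j hij)

/-- The coefficient of `∂/∂x_i`. -/
def xi (V : PointField (Fin 3) Dep) (i : Fin 3) (y : Base) : ℝ := V.ξ y i

/-- The coefficient of `∂/∂u^α_k` in the prolongation of `V`, at `solJet y σ τ`. -/
noncomputable def prolongAt (V : PointField (Fin 3) Dep) (y : Base) (σ τ : Fin 3 → Fin 3 → ℝ)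
    (α : Dep) (k : Fin 3) : ℝ :=
  fderiv ℝ (fun y => V.φ y α) y (solVec y σ τ k)
    - ∑ r, fderiv ℝ (xi V r) y (solVec y σ τ k) * jetCoeff y σ τ α r

lemma prolong_solJet (y : Base) (σ τ : Fin 3 → Fin 3 → ℝ) :
    V.prolong (solJet y σ τ) = (V.ξ y, V.φ y, prolongAt V y σ τ) := rfl

variable (hV : IsInfinitesimalGenerator system M V) {y : Base} (hyM : y ∈ M)
  (hy : y ∈ guichardSet) {σ τ : Fin 3 → Fin 3 → ℝ}
  (hσ : ∀ i j, σ j i = -σ i j) (hτ : ∀ i j, τ j i = -τ i j)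
include hV hyM hy hσ hτ

lemma criterion_apply {Δ : Jet → ℝ} (hΔ : IsEquation Δ) {Δ' : Jet →L[ℝ] ℝ}
    (h' : HasFDerivAt Δ Δ' (solJet y σ τ)) :
    Δ' (V.ξ y, V.φ y, prolongAt V y σ τ) = 0 := by
  have := hV.criterion (solJet y σ τ) hyM (solJet_mem hy hσ hτ) Δ hΔ
  rwa [h'.fderiv, prolong_solJet] at this

lemma prolong_B {i j : Fin 3} (hij : i ≠ j) :
    prolongAt V y σ τ (lIdx i) j = phi V i j hij y * lv y j + hv y i j * eta V j y := by
  have := criterion_apply hV hyM hy hσ hτ (IsEquation.B i j hij)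
    ((hasFDerivAt_p (lIdx i) j _).sub ((hasFDerivAt_u (hIdx i j hij) _).mul
      (hasFDerivAt_u (lIdx j) _)))
  simp [solJet, l] at this
  rw [hv_of_ne y hij]
  simp only [phi, lv, eta]
  linarith

lemma prolong_C {i j k : Fin 3} (hij : i ≠ j) (hik : i ≠ k) (hjk : j ≠ k) :
    ε i * prolongAt V y σ τ (lIdx i) i
      + ε j * (phi V j i hij.symm y * lv y j + hv y j i * eta V j y)
      + ε k * (phi V k i hik.symm y * lv y k + hv y k i * eta V k y) = 0 := by
  have := criterion_apply hV hyM hy hσ hτ (IsEquation.C i j k hij hik hjk)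
    ((((hasFDerivAt_p (lIdx i) i _).const_mul (ε i)).add
      (((hasFDerivAt_u (hIdx j i hij.symm) _).const_mul (ε j)).mul
      (hasFDerivAt_u (lIdx j) _))).add
      (((hasFDerivAt_u (hIdx k i hik.symm) _).const_mul (ε k)).mul
      (hasFDerivAt_u (lIdx k) _)))
  simp [solJet, l] at this
  rw [hv_of_ne y hij.symm, hv_of_ne y hik.symm]
  simp only [phi, lv, eta]
  linarith

lemma prolong_D {i j k : Fin 3} (hij : i ≠ j) (hik : i ≠ k) (hjk : j ≠ k) :
    prolongAt V y σ τ (hIdx i j hij) k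
      = phi V i k hik y * hv y k j + hv y i k * phi V k j hjk.symm y := by
  have := criterion_apply hV hyM hy hσ hτ (IsEquation.D i j k hij hik hjk)
    ((hasFDerivAt_p (hIdx i j hij) k _).sub ((hasFDerivAt_u (hIdx i k hik) _).mul
      (hasFDerivAt_u (hIdx k j hjk.symm) _)))
  simp [solJet, h] at this
  rw [hv_of_ne y hik, hv_of_ne y hjk.symm]
  simp only [phi]
  linarith

lemma prolong_E {i j k : Fin 3} (hij : i ≠ j) (hik : i ≠ k) (hjk : j ≠ k) :
    prolongAt V y σ τ (hIdx i j hij) j + prolongAt V y σ τ (hIdx j i hij.symm) i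
      + (phi V i k hik y * hv y j k + hv y i k * phi V j k hjk y) = 0 := by
  have := criterion_apply hV hyM hy hσ hτ (IsEquation.E i j k hij hik hjk)
    (((hasFDerivAt_p (hIdx i j hij) j _).add (hasFDerivAt_p (hIdx j i hij.symm) i _)).add
      ((hasFDerivAt_u (hIdx i k hik) _).mul (hasFDerivAt_u (hIdx j k hjk) _)))
  simp [solJet, h] at this
  rw [hv_of_ne y hik, hv_of_ne y hjk]
  simp only [phi]
  linarith

lemma prolong_F {i j k : Fin 3} (hij : i ≠ j) (hik : i ≠ k) (hjk : j ≠ k) :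
    ε i * prolongAt V y σ τ (hIdx i j hij) i + ε j * prolongAt V y σ τ (hIdx j i hij.symm) j
      + ε k * (phi V k i hik.symm y * hv y k j + hv y k i * phi V k j hjk.symm y) = 0 := by
  have := criterion_apply hV hyM hy hσ hτ (IsEquation.F i j k hij hik hjk)
    ((((hasFDerivAt_p (hIdx i j hij) i _).const_mul (ε i)).add
      ((hasFDerivAt_p (hIdx j i hij.symm) j _).const_mul (ε j))).add
      (((hasFDerivAt_u (hIdx k i hik.symm) _).const_mul (ε k)).mul
        (hasFDerivAt_u (hIdx k j hjk.symm) _)))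
  simp [solJet, h] at this
  rw [hv_of_ne y hik.symm, hv_of_ne y hjk.symm]
  simp only [phi]
  linarith
end

/-! ### Tangent directions of the cone -/

lemma mem_guichardSet {y : Base} :
    y ∈ guichardSet ↔ lv y 1 ^ 2 = lv y 0 ^ 2 + lv y 2 ^ 2 := by
  simp only [guichardSet, Set.mem_ofPred_eq, Fin.sum_univ_three, ε, lv]
  simp
  constructor <;> intro h <;> linarith

lemma lv_eq_zero {y : Base} (hy : y ∈ guichardSet) (h1 : lv y 1 = 0) (i : Fin 3) : lv y i = 0 := by
  rw [mem_guichardSet, h1] at hy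
  have h0 : lv y 0 = 0 := by nlinarith [sq_nonneg (lv y 0), sq_nonneg (lv y 2)]
  have h2 : lv y 2 = 0 := by nlinarith [sq_nonneg (lv y 0), sq_nonneg (lv y 2)]
  fin_cases i <;> assumption

/-- The vector `w` is tangent at `y` to the cone `l_1² = l_0² + l_2²`. At the vertices `l = 0`, where
the cone is singular, this means that `w` has no component in the `l`-directions. -/
def IsTangent (y w : Base) : Prop :=
  lv y 1 * lv w 1 = lv y 0 * lv w 0 + lv y 2 * lv w 2 ∧ (lv y 1 = 0 → ∀ i, lv w i = 0)

lemma isTangent_of_lv_eq_zero {w : Base} (y : Base) (h : ∀ i, lv w i = 0) : IsTangent y w :=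
  ⟨by simp [h], fun _ => h⟩

lemma isTangent_eX (y : Base) (k : Fin 3) : IsTangent y (eX k) :=
  isTangent_of_lv_eq_zero y fun i => by simp [lv, eX]

lemma isTangent_eH (y : Base) {i j : Fin 3} (hij : i ≠ j) : IsTangent y (eH i j hij) :=
  isTangent_of_lv_eq_zero y fun i => by simp [lv, eH]

lemma lv_rot (m k i : Fin 3) (y : Base) : lv (rot m k y) i
    = (if i = m then lv y k else 0) - (if i = k then ε k * ε m * lv y m else 0) := by
  simp [rot, lv, eL, Pi.single_apply]

lemma isTangent_rot {y : Base} (hy : y ∈ guichardSet) (m k : Fin 3) : IsTangent y (rot m k y) := by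
  constructor
  · fin_cases m <;> fin_cases k <;> simp [lv_rot, ε] <;> ring
  · intro h i
    simp [lv_rot, lv_eq_zero hy h]

lemma IsTangent.add {y v w : Base} (hv : IsTangent y v) (hw : IsTangent y w) :
    IsTangent y (v + w) := by
  refine ⟨?_, fun h i => ?_⟩
  · have := hv.1; have := hw.1
    simp only [lv, Prod.snd_add, Pi.add_apply] at *
    linarith
  · have := hv.2 h i; have := hw.2 h i
    simp only [lv, Prod.snd_add, Pi.add_apply] at *
    linarith

lemma IsTangent.smul {y w : Base} (hw : IsTangent y w) (c : ℝ) : IsTangent y (c • w) := by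
  refine ⟨?_, fun h i => ?_⟩
  · have := hw.1
    simp only [lv, Prod.smul_snd, Pi.smul_apply, smul_eq_mul] at *
    linear_combination c * this
  · have := hw.2 h i
    simp only [lv, Prod.smul_snd, Pi.smul_apply, smul_eq_mul] at *
    rw [this, mul_zero]

lemma eq_sum_basis (w : Base) : w = ∑ k, w.1 k • eX k + ∑ i, lv w i • eL i
    + ∑ s : {s : Fin 3 × Fin 3 // s.1 ≠ s.2}, w.2 (Sum.inr s) • eH s.1.1 s.1.2 s.2 := by
  refine Prod.ext ?_ ?_
  · simp only [Prod.fst_add, Prod.fst_sum, Prod.smul_fst, eX, eL, eH, smul_zero,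
      Finset.sum_const_zero, add_zero]
    exact pi_eq_sum_univ' _
  · simp only [Prod.snd_add, Prod.snd_sum, Prod.smul_snd, eX, eL, eH, smul_zero,
      Finset.sum_const_zero, zero_add, lv]
    conv_lhs => rw [pi_eq_sum_univ' w.2]
    rw [Fintype.sum_sum_type]

/-- Translations in `x` and `h` and rotations in `l` span the directions tangent to the cone. -/
lemma map_eq_zero_of_isTangent {L : Base →L[ℝ] ℝ} {y w : Base}
    (hX : ∀ k, L (eX k) = 0) (hH : ∀ i j (hij : i ≠ j), L (eH i j hij) = 0)
    (hR : ∀ m k, m ≠ k → L (rot m k y) = 0) (hw : IsTangent y w) : L w = 0 := by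
  rw [eq_sum_basis w]
  simp only [map_add, map_sum, map_smul, hX, hH, mul_zero, Finset.sum_const_zero, zero_add,
    add_zero, Fin.sum_univ_three, smul_eq_mul]
  by_cases h1 : lv y 1 = 0
  · simp [hw.2 h1]
  · have h01 := hR 0 1 (by decide)
    have h21 := hR 2 1 (by decide)
    simp only [rot, map_sub, map_smul, smul_eq_mul, ε] at h01 h21
    simp at h01 h21
    apply mul_left_cancel₀ h1
    linear_combination L (eL 1) * hw.1 + lv w 0 * h01 + lv w 2 * h21

/-- The projection to the half `s l_1 ≥ 0` of the cone, `s = ±1`, in the direction of `l_1`: this half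
is the graph of `s √(l_0² + l_2²)`. -/
noncomputable def graphMap (s : ℝ) (y : Base) : Base :=
  y + (s * √(lv y 0 ^ 2 + lv y 2 ^ 2) - lv y 1) • eL 1

lemma lv_graphMap (s : ℝ) (y : Base) (i : Fin 3) :
    lv (graphMap s y) i = if i = 1 then s * √(lv y 0 ^ 2 + lv y 2 ^ 2) else lv y i := by
  fin_cases i <;> simp [graphMap, lv, eL]

lemma graphMap_mem {s : ℝ} (hs : s ^ 2 = 1) (y : Base) : graphMap s y ∈ guichardSet := by
  rw [mem_guichardSet]
  simp [lv_graphMap, mul_pow, hs, Real.sq_sqrt (add_nonneg (sq_nonneg (lv y 0)) (sq_nonneg _))]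

lemma graphMap_eq_self {s : ℝ} {y : Base} (hs : s ^ 2 = 1) (hy : y ∈ guichardSet)
    (hpos : 0 ≤ s * lv y 1) : graphMap s y = y := by
  rw [mem_guichardSet] at hy
  have : √(lv y 0 ^ 2 + lv y 2 ^ 2) = s * lv y 1 := by
    rw [← hy, show lv y 1 ^ 2 = (s * lv y 1) ^ 2 by rw [mul_pow, hs, one_mul], Real.sqrt_sq hpos]
  rw [graphMap, this, ← mul_assoc, ← sq, hs]
  simp

lemma continuous_lv (i : Fin 3) : Continuous fun y : Base => lv y i := by
  unfold lv; fun_prop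

lemma continuous_graphMap (s : ℝ) : Continuous (graphMap s) := by
  unfold graphMap
  have := continuous_lv
  fun_prop

lemma hasDerivAt_add_smul (y w : Base) (t : ℝ) : HasDerivAt (fun t : ℝ => y + t • w) w t := by
  simpa using ((hasDerivAt_id t).smul_const w).const_add y

lemma lv_line (y w : Base) (t : ℝ) (i : Fin 3) : lv (y + t • w) i = lv y i + t * lv w i := by
  simp [lv]

lemma hasDerivAt_graphMap {s : ℝ} {y w : Base} {t : ℝ}
    (h : lv (y + t • w) 0 ^ 2 + lv (y + t • w) 2 ^ 2 ≠ 0) :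
    HasDerivAt (fun t : ℝ => graphMap s (y + t • w))
      (w + (s * ((lv (y + t • w) 0 * lv w 0 + lv (y + t • w) 2 * lv w 2)
        / √(lv (y + t • w) 0 ^ 2 + lv (y + t • w) 2 ^ 2)) - lv w 1) • eL 1) t := by
  have hl : ∀ i, HasDerivAt (fun t : ℝ => lv (y + t • w) i) (lv w i) t := fun i => by
    simp only [lv_line]
    simpa using ((hasDerivAt_id t).mul_const (lv w i)).const_add (lv y i)
  refine (hasDerivAt_add_smul y w t).add
    ((((((hl 0).pow 2).add ((hl 2).pow 2)).sqrt h).const_mul s).sub (hl 1)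
      |>.smul_const (eL 1) |>.congr_deriv ?_)
  congr 3
  simp
  field_simp

lemma isTangent_deriv_graphMap {s : ℝ} (hs : s ^ 2 = 1) {z w : Base}
    (h : lv z 0 ^ 2 + lv z 2 ^ 2 ≠ 0) :
    IsTangent (graphMap s z)
      (w + (s * ((lv z 0 * lv w 0 + lv z 2 * lv w 2) / √(lv z 0 ^ 2 + lv z 2 ^ 2))
        - lv w 1) • eL 1) := by
  have hq : 0 < √(lv z 0 ^ 2 + lv z 2 ^ 2) := Real.sqrt_pos.2 (by positivity)
  have e (i : Fin 3) (c : ℝ) : lv (w + c • eL 1) i = lv w i + if i = 1 then c else 0 := by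
    simp [lv, eL, Pi.single_apply]
  refine ⟨?_, fun h1 => absurd h1 ?_⟩
  · simp [lv_graphMap, e]
    field_simp
    rw [hs, one_mul]
  · simp [lv_graphMap]
    exact ⟨by rintro rfl; norm_num at hs, hq.ne'⟩

lemma exists_sign {r : ℝ} (hr : r ≠ 0) : ∃ s : ℝ, s ^ 2 = 1 ∧ 0 < s * r := by
  rcases hr.lt_or_gt with h | h
  · exact ⟨-1, by norm_num, by linarith⟩
  · exact ⟨1, by norm_num, by linarith⟩

lemma line_mem_guichardSet {y v : Base} (hy : y ∈ guichardSet) (hv : ∀ i, lv v i = 0) (t : ℝ) :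
    y + t • v ∈ guichardSet := by
  rw [mem_guichardSet] at *
  simpa [lv_line, hv] using hy

/-- A function that vanishes on the cone has vanishing derivative in the directions tangent to the
cone. -/
lemma fderiv_eq_zero_of_isTangent {M : Set Base} (hM : IsOpen M) {g : Base → ℝ} {y w : Base}
    (hyM : y ∈ M) (hy : y ∈ guichardSet) (hg : DifferentiableAt ℝ g y)
    (h0 : ∀ z ∈ M, z ∈ guichardSet → g z = 0) (hw : IsTangent y w) : fderiv ℝ g y w = 0 := by
  have key : ∀ γ : ℝ → Base, γ 0 = y → HasDerivAt γ w 0 → (∀ t, γ t ∈ guichardSet) →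
      fderiv ℝ g y w = 0 := by
    intro γ hγ0 hγ hγm
    subst hγ0
    have h1 : HasDerivAt (g ∘ γ) (fderiv ℝ g (γ 0) w) 0 := hg.hasFDerivAt.comp_hasDerivAt 0 hγ
    have h2 : g ∘ γ =ᶠ[𝓝 0] fun _ => 0 := by
      filter_upwards [hγ.continuousAt.preimage_mem_nhds (hM.mem_nhds hyM)] with t ht
      exact h0 _ ht (hγm t)
    exact h1.unique ((hasDerivAt_const (0 : ℝ) (0 : ℝ)).congr_of_eventuallyEq h2)
  by_cases h1 : lv y 1 = 0
  · exact key (fun t => y + t • w) (by simp) (hasDerivAt_add_smul y w 0)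
      (line_mem_guichardSet hy (hw.2 h1))
  · obtain ⟨s, hs, hpos⟩ := exists_sign h1
    have hself := graphMap_eq_self hs hy hpos.le
    have hq : lv y 0 ^ 2 + lv y 2 ^ 2 ≠ 0 := by
      rw [← mem_guichardSet.1 hy]; positivity
    refine key (fun t => graphMap s (y + t • w)) (by simp [hself]) ?_ (fun t => graphMap_mem hs _)
    refine (hasDerivAt_graphMap (t := 0) (by simpa using hq)).congr_deriv ?_
    have hsq : √(lv y 0 ^ 2 + lv y 2 ^ 2) = s * lv y 1 := by
      rw [← mem_guichardSet.1 hy, show lv y 1 ^ 2 = (s * lv y 1) ^ 2 by rw [mul_pow, hs, one_mul],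
        Real.sqrt_sq hpos.le]
    simp only [zero_smul, add_zero, hsq, ← hw.1]
    have hs0 : s ≠ 0 := by rintro rfl; norm_num at hs
    rw [show s * (lv y 1 * lv w 1 / (s * lv y 1)) - lv w 1 = 0 by field_simp; ring]
    simp

/-! ### The coefficients of the translations in `x` and the shape of `φ` -/

section
variable {M : Set Base} (hM : IsOpen M) {f : Base → ℝ} (hf : ContDiffOn ℝ ∞ f M) {y : Base}
  (hyM : y ∈ M)
include hM hf hyM

/-- The symmetry of second derivatives, for the derivative along a line. -/
lemma hasDerivAt_fderiv_line (v w : Base) :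
    HasDerivAt (fun t : ℝ => fderiv ℝ f (y + t • v) w)
      (fderiv ℝ (fun z => fderiv ℝ f z v) y w) 0 := by
  have hfy : ContDiffAt ℝ ∞ f y := hf.contDiffAt (hM.mem_nhds hyM)
  have hd : DifferentiableAt ℝ (fderiv ℝ f) y :=
    (hfy.fderiv_right (m := 1) (by norm_cast)).differentiableAt (by norm_num)
  have hsym : IsSymmSndFDerivAt ℝ f y := hfy.isSymmSndFDerivAt 
    (by simpa using WithTop.coe_le_coe.2 (le_top : (2 : ℕ∞) ≤ ⊤))
  have h1 : HasDerivAt (fun t : ℝ => fderiv ℝ f (y + t • v)) (fderiv ℝ (fderiv ℝ f) y v) 0 := by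
    have hd' : HasFDerivAt (fderiv ℝ f) (fderiv ℝ (fderiv ℝ f) y) (y + (0 : ℝ) • v) := by
      simpa using hd.hasFDerivAt
    exact hd'.comp_hasDerivAt 0 (hasDerivAt_add_smul y v 0)
  have h2 : fderiv ℝ (fun z => fderiv ℝ f z v) y w = fderiv ℝ (fderiv ℝ f) y v w := by
    rw [fderiv_clm_apply hd (differentiableAt_const v)]
    simp [hsym.eq v w]
  rw [h2]
  simpa using h1.clm_apply (hasDerivAt_const 0 w)

lemma differentiableAt_fderiv_apply (v : Base) :
    DifferentiableAt ℝ (fun z => fderiv ℝ f z v) y :=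
  (((hf.contDiffAt (hM.mem_nhds hyM)).fderiv_right (m := 1) (by norm_cast)).differentiableAt
    (by norm_num)).clm_apply (differentiableAt_const v)

/-- If `∂_v f` vanishes on the cone and `w` is tangent to the cone at `y`, then
`∂_v ∂_w f = ∂_w ∂_v f = 0` at `y`. Hence, when `∂_{w + t u} f` is differentiated along the line
`y + t v`, only the change `u` of the direction contributes. -/
lemma hasDerivAt_fderiv_line_of_isTangent {v w : Base} (hy : y ∈ guichardSet)
    (hv : ∀ z ∈ M, z ∈ guichardSet → fderiv ℝ f z v = 0) (hw : IsTangent y w) (u : Base) :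
    HasDerivAt (fun t : ℝ => fderiv ℝ f (y + t • v) (w + t • u)) (fderiv ℝ f y u) 0 := by
  have h1 := hasDerivAt_fderiv_line hM hf hyM v w
  rw [fderiv_eq_zero_of_isTangent hM hyM hy (differentiableAt_fderiv_apply hM hf hyM v) hv hw] at h1
  have h2 := (hasDerivAt_id (0 : ℝ)).mul (hasDerivAt_fderiv_line hM hf hyM v u)
  simp only [map_add, map_smul, smul_eq_mul]
  exact (h1.add h2).congr_deriv (by simp)

end

/-- Equations between functions on the cone may be differentiated along lines in `x` and `h`. -/
lemma deriv_line_unique {M : Set Base} (hM : IsOpen M) {y v : Base} (hyM : y ∈ M)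
    (hy : y ∈ guichardSet) (hv : ∀ i, lv v i = 0) {f g : Base → ℝ} {a b : ℝ}
    (h : ∀ z ∈ M, z ∈ guichardSet → f z = g z)
    (ha : HasDerivAt (fun t : ℝ => f (y + t • v)) a 0)
    (hb : HasDerivAt (fun t : ℝ => g (y + t • v)) b 0) : a = b := by
  refine ha.unique (hb.congr_of_eventuallyEq ?_)
  have hc : ContinuousAt (fun t : ℝ => y + t • v) 0 := by fun_prop
  filter_upwards [hc.preimage_mem_nhds (hM.mem_nhds (by simpa using hyM))] with t ht
  exact h _ ht (line_mem_guichardSet hy hv t)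

lemma lv_eH {i j : Fin 3} (hij : i ≠ j) (m : Fin 3) : lv (eH i j hij) m = 0 := by
  simp [lv, eH]

lemma lv_add_eH (y : Base) (t : ℝ) {i j : Fin 3} (hij : i ≠ j) (m : Fin 3) :
    lv (y + t • eH i j hij) m = lv y m := by
  simp [lv_line, lv_eH]

lemma rot_add_eH (y : Base) (t : ℝ) {i j : Fin 3} (hij : i ≠ j) (m k : Fin 3) :
    rot m k (y + t • eH i j hij) = rot m k y := by
  simp [rot, lv_add_eH]

lemma hv_add_eH (y : Base) (t : ℝ) {i j : Fin 3} (hij : i ≠ j) (m k : Fin 3) :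
    hv (y + t • eH i j hij) m k = hv y m k + if m = i ∧ k = j then t else 0 := by
  unfold hv eH
  split_ifs with h1 h2 h2
  · simp [h2]
  · simp [h2]
  · exact absurd (h2.1.trans_ne (hij.trans_eq h2.2.symm)) h1
  · simp

lemma third_index {i j k : Fin 3} (hij : i ≠ j) (hik : i ≠ k) (hjk : j ≠ k) : -(i + j) = k := by
  revert i j k; decide

lemma exists_third_index {i j : Fin 3} (hij : i ≠ j) : ∃ k, i ≠ k ∧ j ≠ k := by
  revert i j; decide

lemma sum_eq_of_distinct {i j k : Fin 3} (hij : i ≠ j) (hik : i ≠ k) (hjk : j ≠ k)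
    (f : Fin 3 → ℝ) : ∑ r, f r = f i + f j + f k := by
  have : (Finset.univ : Finset (Fin 3)) = {i, j, k} := by
    revert i j k; decide
  rw [this, Finset.sum_insert (by simp [hij, hik]), Finset.sum_insert (by simp [hjk]),
    Finset.sum_singleton, add_assoc]

section
variable (y : Base) (σ τ : Fin 3 → Fin 3 → ℝ) {i j k : Fin 3} (hij : i ≠ j) (hik : i ≠ k)
  (hjk : j ≠ k)

include hij in
lemma jetCoeff_l_of_ne : jetCoeff y σ τ (lIdx i) j = hv y i j * lv y j := if_neg hij

include hij hik hjk

lemma jetCoeff_l_self : jetCoeff y σ τ (lIdx i) i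
    = -(ε i * (ε j * hv y j i * lv y j + ε k * hv y k i * lv y k)) := by
  simp [jetCoeff, sum_eq_of_distinct hij hik hjk, hv]

lemma jetCoeff_h_left : jetCoeff y σ τ (hIdx i j hij) i
    = ε i * (τ i j - ε k * hv y k i * hv y k j / 2) := by
  simp [jetCoeff, third_index hij hik hjk]

lemma jetCoeff_h_right : jetCoeff y σ τ (hIdx i j hij) j
    = σ i j - hv y i k * hv y j k / 2 := by
  simp only [jetCoeff, third_index hij hik hjk, if_neg hij.symm, if_true]

lemma jetCoeff_h_third : jetCoeff y σ τ (hIdx i j hij) k = hv y i k * hv y k j := by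
  simp only [jetCoeff, if_neg hik.symm, if_neg hjk.symm]
end

/-- The antisymmetric matrix with entries `1` at `(a, b)` and `-1` at `(b, a)`. -/
def asym (a b : Fin 3) (i j : Fin 3) : ℝ :=
  (if i = a ∧ j = b then 1 else 0) - if i = b ∧ j = a then 1 else 0

lemma asym_symm (a b i j : Fin 3) : asym a b j i = -asym a b i j := by
  simp [asym, and_comm]

lemma ε_mul_self (i : Fin 3) : ε i * ε i = 1 := by
  fin_cases i <;> simp [ε]

lemma ε_ne_zero (i : Fin 3) : ε i ≠ 0 := fun h => by simpa [h] using ε_mul_self i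

/-- If a functional does not see the free parameters of the jet in `D_k`, then it vanishes on the
directions `∂/∂h_{ik}` and `∂/∂h_{ki}`. -/
lemma map_eH_eq_zero {y : Base} {k : Fin 3} {L : Base →L[ℝ] ℝ} {c : ℝ}
    (hL : ∀ σ τ : Fin 3 → Fin 3 → ℝ, (∀ i j, σ j i = -σ i j) → (∀ i j, τ j i = -τ i j) →
      L (solVec y σ τ k) = c) {i : Fin 3} (hik : i ≠ k) :
    L (eH i k hik) = 0 ∧ L (eH k i hik.symm) = 0 := by
  obtain ⟨j, hij, hkj⟩ := exists_third_index hik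
  have h0 := hL 0 0 (by simp) (by simp)
  have h1 := hL (asym i k) 0 (asym_symm i k) (by simp)
  have h2 := hL 0 (asym k i) (by simp) (asym_symm k i)
  rw [solVec_eq y _ _ hij hik hkj.symm] at h0 h1 h2
  simp [asym, hik, hij.symm, hkj.symm] at h0 h1 h2
  refine ⟨by linarith, ?_⟩
  apply mul_left_cancel₀ (ε_ne_zero k)
  linarith

/-- The part of `D_k` at a solution jet that involves neither derivatives of `h` nor free parameters;
here `i, j, k` are the three indices. -/
noncomputable def horVec (i j k : Fin 3) (y : Base) : Base :=
  eX k + hv y i k • rot i k y + hv y j k • rot j k y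

lemma isTangent_horVec {y : Base} (hy : y ∈ guichardSet) (i j k : Fin 3) :
    IsTangent y (horVec i j k y) :=
  ((isTangent_eX y k).add ((isTangent_rot hy i k).smul _)).add ((isTangent_rot hy j k).smul _)

lemma map_solVec {L : Base →L[ℝ] ℝ} {k : Fin 3}
    (hL : ∀ i (hik : i ≠ k), L (eH i k hik) = 0 ∧ L (eH k i hik.symm) = 0) (y : Base)
    (σ τ : Fin 3 → Fin 3 → ℝ) {i j : Fin 3} (hij : i ≠ j) (hik : i ≠ k) (hjk : j ≠ k) :
    L (solVec y σ τ k) = L (horVec i j k y + ((hv y i k * hv y k j) • eH i j hij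
      + (hv y j k * hv y k i) • eH j i hij.symm)) := by
  rw [solVec_eq y σ τ hij hik hjk, horVec]
  simp [hL i hik, hL j hjk]
  ring

lemma rot_symm (m k : Fin 3) (y : Base) : rot k m y = -(ε k * ε m) • rot m k y := by
  have h : (ε k * ε m) * (ε k * ε m) = 1 := by
    linear_combination ε k ^ 2 * ε_mul_self m + ε_mul_self k
  rw [rot, rot, smul_sub, smul_smul, smul_smul]
  rw [show -(ε k * ε m) * (ε k * ε m * lv y m) = -lv y m by linear_combination (-lv y m) * h,
    show ε m * ε k * lv y k = ε k * ε m * lv y k by ring]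
  module

section
variable {M : Set Base} {V : PointField (Fin 3) Dep} (hM : IsOpen M)
  (hV : IsInfinitesimalGenerator system M V)
include hV

lemma contDiffOn_xi (i : Fin 3) : ContDiffOn ℝ ∞ (xi V i) M :=
  contDiffOn_pi.1 hV.smooth_ξ i

lemma contDiffOn_phi (i j : Fin 3) (hij : i ≠ j) : ContDiffOn ℝ ∞ (phi V i j hij) M :=
  contDiffOn_pi.1 hV.smooth_φ (hIdx i j hij)

lemma contDiffOn_eta (i : Fin 3) : ContDiffOn ℝ ∞ (eta V i) M :=
  contDiffOn_pi.1 hV.smooth_φ (lIdx i)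

section
variable {y : Base} (hyM : y ∈ M) (hy : y ∈ guichardSet)
include hyM hy

/-- `D_k ξ^i` vanishes on the solution jets for `i ≠ k`: with `j` the third index, it is the
coefficient of the free derivative `h_{ij,i}`, on which `D_k` does not depend, in the criterion for
`h_{ij,k} = h_{ik} h_{kj}`. -/
lemma fderiv_xi_solVec {i k : Fin 3} (hik : i ≠ k) {σ τ : Fin 3 → Fin 3 → ℝ}
    (hσ : ∀ i j, σ j i = -σ i j) (hτ : ∀ i j, τ j i = -τ i j) :
    fderiv ℝ (xi V i) y (solVec y σ τ k) = 0 := by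
  obtain ⟨j, hij, hkj⟩ := exists_third_index hik
  have h1 := prolong_D hV hyM hy hσ hτ hij hik hkj.symm
  have h2 := prolong_D hV hyM hy hσ (τ := τ + asym i j)
    (fun a b => by simp [hτ a b, asym_symm i j a b, add_comm]) hij hik hkj.symm
  have hX : solVec y σ (τ + asym i j) k = solVec y σ τ k := by
    rw [solVec_eq y σ τ hij hik hkj.symm, solVec_eq y σ _ hij hik hkj.symm]
    simp [asym, hik.symm, hkj]
  rw [prolongAt, sum_eq_of_distinct hij hik hkj.symm, jetCoeff_h_left y _ _ hij hik hkj.symm,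
    jetCoeff_h_right y _ _ hij hik hkj.symm, jetCoeff_h_third y _ _ hij hik hkj.symm] at h1 h2
  rw [hX] at h2
  have h3 : asym i j i j = 1 := by simp [asym, hij]
  simp only [Pi.add_apply, h3] at h2
  apply mul_left_cancel₀ (ε_ne_zero i)
  linear_combination h1 - h2

lemma fderiv_xi_eH (r i j : Fin 3) (hij : i ≠ j) : fderiv ℝ (xi V r) y (eH i j hij) = 0 := by
  have key {k : Fin 3} (hrk : r ≠ k) {a : Fin 3} (hak : a ≠ k) :=
    map_eH_eq_zero (fun σ τ hσ hτ => fderiv_xi_solVec hV hyM hy hrk (σ := σ) (τ := τ) hσ hτ) hak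
  by_cases hr : r = j
  · exact (key (hr.trans_ne hij.symm) hij.symm).2
  · exact (key hr hij).1

end

include hM

section
variable {y : Base} (hyM : y ∈ M) (hy : y ∈ guichardSet)
include hyM hy

/-- Obtained from `D_k ξ^r = 0` by differentiation with respect to `h_{mk}`. -/
lemma fderiv_xi_rot_aux {r k m : Fin 3} (hrk : r ≠ k) (hmk : m ≠ k) :
    fderiv ℝ (xi V r) y (rot m k y) = 0 := by
  obtain ⟨j, hmj, hkj⟩ := exists_third_index hmk
  have h0 : ∀ z ∈ M, z ∈ guichardSet → fderiv ℝ (xi V r) z (horVec m j k z) = 0 := by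
    intro z hzM hz
    have := fderiv_xi_solVec hV hzM hz hrk (σ := 0) (τ := 0) (by simp) (by simp)
    rw [map_solVec (fun i hik => ⟨fderiv_xi_eH hV hzM hz r _ _ _, fderiv_xi_eH hV hzM hz r _ _ _⟩)
      z 0 0 hmj hmk hkj.symm] at this
    simpa [fderiv_xi_eH hV hzM hz] using this
  refine deriv_line_unique hM hyM hy (lv_eH hmk) h0 ?_ (hasDerivAt_const _ _)
  have := hasDerivAt_fderiv_line_of_isTangent hM (contDiffOn_xi hV r) hyM hy
    (fun z hzM hz => fderiv_xi_eH hV hzM hz r m k hmk) (isTangent_horVec hy m j k) (rot m k y)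
  convert this using 3 with t
  simp [horVec, rot_add_eH, hv_add_eH, hmj.symm]
  module

lemma fderiv_xi_rot (r m k : Fin 3) (hmk : m ≠ k) :
    fderiv ℝ (xi V r) y (rot m k y) = 0 := by
  by_cases hr : r = k
  · rw [rot_symm k m, map_smul, fderiv_xi_rot_aux hM hV hyM hy (hr.trans_ne hmk.symm) hmk.symm,
      smul_zero]
  · exact fderiv_xi_rot_aux hM hV hyM hy hr hmk

lemma fderiv_xi_solVec_eq (r k : Fin 3) (σ τ : Fin 3 → Fin 3 → ℝ) :
    fderiv ℝ (xi V r) y (solVec y σ τ k) = fderiv ℝ (xi V r) y (eX k) := by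
  obtain ⟨i, j, hij, hik, hjk⟩ : ∃ i j : Fin 3, i ≠ j ∧ i ≠ k ∧ j ≠ k := by revert k; decide
  rw [solVec_eq y σ τ hij hik hjk]
  simp [fderiv_xi_eH hV hyM hy, fderiv_xi_rot hM hV hyM hy, hik, hjk]

lemma fderiv_xi_eX {r k : Fin 3} (hrk : r ≠ k) : fderiv ℝ (xi V r) y (eX k) = 0 := by
  rw [← fderiv_xi_solVec_eq hM hV hyM hy r k 0 0]
  exact fderiv_xi_solVec hV hyM hy hrk (by simp) (by simp)

/-- As `D_k ξ^r` vanishes for `r ≠ k`, the prolongation has only one correction term. -/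
lemma prolongAt_eq (σ τ : Fin 3 → Fin 3 → ℝ) (α : Dep) (k : Fin 3) :
    prolongAt V y σ τ α k = fderiv ℝ (fun y => V.φ y α) y (solVec y σ τ k)
      - fderiv ℝ (xi V k) y (eX k) * jetCoeff y σ τ α k := by
  rw [prolongAt, Finset.sum_eq_single k, fderiv_xi_solVec_eq hM hV hyM hy]
  · intro r _ hr
    rw [fderiv_xi_solVec_eq hM hV hyM hy, fderiv_xi_eX hM hV hyM hy hr, zero_mul]
  · simp

lemma prolong_h_third {i j k : Fin 3} (hij : i ≠ j) (hik : i ≠ k) (hjk : j ≠ k)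
    {σ τ : Fin 3 → Fin 3 → ℝ} (hσ : ∀ i j, σ j i = -σ i j) (hτ : ∀ i j, τ j i = -τ i j) :
    fderiv ℝ (phi V i j hij) y (solVec y σ τ k)
      = fderiv ℝ (xi V k) y (eX k) * (hv y i k * hv y k j)
        + (phi V i k hik y * hv y k j + hv y i k * phi V k j hjk.symm y) := by
  have := prolong_D hV hyM hy hσ hτ hij hik hjk
  rw [prolongAt_eq hM hV hyM hy, jetCoeff_h_third y _ _ hij hik hjk] at this
  unfold phi at this ⊢
  linear_combination this

/-- Among the `h`, on the cone `φ^{ij}` depends on `h_{ij}` and `h_{ji}` only. -/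
lemma fderiv_phi_eH {i j k : Fin 3} (hij : i ≠ j) (hik : i ≠ k) (hjk : j ≠ k) {a : Fin 3}
    (hak : a ≠ k) : fderiv ℝ (phi V i j hij) y (eH a k hak) = 0
      ∧ fderiv ℝ (phi V i j hij) y (eH k a hak.symm) = 0 :=
  map_eH_eq_zero (fun _ _ hσ hτ => prolong_h_third hM hV hyM hy hij hik hjk hσ hτ) hak

/-- Comparing the coefficients of the free parameters in the equations for
`h_{ij,j} + h_{ji,i}` and `ε_i h_{ij,i} + ε_j h_{ji,j}`. With `c_{ij} = ∂φ^{ij}/∂h_{ij}` and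
`a_i = ∂ξ^i/∂x_i` the former gives `c_{ij} - c_{ji} = a_j - a_i`, the latter
`c_{ij} - c_{ji} = a_i - a_j`. -/
lemma fderiv_xi_eX_and_phi_eH_symm {i j : Fin 3} (hij : i ≠ j) :
    fderiv ℝ (xi V i) y (eX i) = fderiv ℝ (xi V j) y (eX j) ∧
    fderiv ℝ (phi V i j hij) y (eH i j hij)
      = fderiv ℝ (phi V j i hij.symm) y (eH j i hij.symm) := by
  obtain ⟨k, hik, hjk⟩ := exists_third_index hij
  have E0 := prolong_E hV hyM hy (σ := 0) (τ := 0) (by simp) (by simp) hij hik hjk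
  have E1 := prolong_E hV hyM hy (σ := asym i j) (τ := 0) (asym_symm i j) (by simp) hij hik hjk
  have F0 := prolong_F hV hyM hy (σ := 0) (τ := 0) (by simp) (by simp) hij hik hjk
  have F1 := prolong_F hV hyM hy (σ := 0) (τ := asym i j) (by simp) (asym_symm i j) hij hik hjk
  have X1 : solVec y (asym i j) 0 j = solVec y 0 0 j + eH i j hij := by
    rw [solVec_eq y _ _ hik hij hjk.symm, solVec_eq y _ _ hik hij hjk.symm]
    simp [asym, hij, hij.symm, hik.symm, hjk.symm]
    module
  have X2 : solVec y (asym i j) 0 i = solVec y 0 0 i - eH j i hij.symm := by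
    rw [solVec_eq y _ _ hjk hij.symm hik.symm, solVec_eq y _ _ hjk hij.symm hik.symm]
    simp [asym, hij, hij.symm, hik.symm, hjk.symm]
    module
  have X3 : solVec y 0 (asym i j) i = solVec y 0 0 i + ε i • eH i j hij := by
    rw [solVec_eq y _ _ hjk hij.symm hik.symm, solVec_eq y _ _ hjk hij.symm hik.symm]
    simp [asym, hij, hij.symm, hik.symm, hjk.symm]
    module
  have X4 : solVec y 0 (asym i j) j = solVec y 0 0 j - ε j • eH j i hij.symm := by
    rw [solVec_eq y _ _ hik hij hjk.symm, solVec_eq y _ _ hik hij hjk.symm]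
    simp [asym, hij, hij.symm, hik.symm, hjk.symm]
    module
  have s1 : asym i j i j = 1 := by simp [asym, hij]
  have s2 : asym i j j i = -1 := by simp [asym, hij.symm]
  simp only [prolongAt_eq hM hV hyM hy, jetCoeff_h_left y _ _ hij hik hjk,
    jetCoeff_h_right y _ _ hij hik hjk, jetCoeff_h_left y _ _ hij.symm hjk hik,
    jetCoeff_h_right y _ _ hij.symm hjk hik, X1, X2, X3, X4, map_add, map_sub, map_smul, s1, s2,
    smul_eq_mul, Pi.zero_apply] at E0 E1 F0 F1
  have p1 := ε_mul_self i
  have p2 := ε_mul_self j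
  have e : fderiv ℝ (phi V i j hij) y (eH i j hij) - fderiv ℝ (xi V j) y (eX j)
    - (fderiv ℝ (phi V j i hij.symm) y (eH j i hij.symm) - fderiv ℝ (xi V i) y (eX i)) = 0 := by
    unfold phi; linear_combination E1 - E0
  have f : (fderiv ℝ (phi V i j hij) y (eH i j hij) - fderiv ℝ (xi V i) y (eX i))
    - (fderiv ℝ (phi V j i hij.symm) y (eH j i hij.symm) - fderiv ℝ (xi V j) y (eX j)) = 0 := by
    unfold phi; linear_combination F1 - F0
      - (fderiv ℝ (fun y => V.φ y (hIdx i j hij)) y (eH i j hij) - fderiv ℝ (xi V i) y (eX i)) * p1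
      + (fderiv ℝ (fun y => V.φ y (hIdx j i hij.symm)) y (eH j i hij.symm)
        - fderiv ℝ (xi V j) y (eX j)) * p2
  constructor <;> linarith

end
end

/-! ### The coefficients `φ` and `η` -/

lemma hasDerivAt_line {f : Base → ℝ} {y : Base} (hf : DifferentiableAt ℝ f y) (v : Base) :
    HasDerivAt (fun t : ℝ => f (y + t • v)) (fderiv ℝ f y v) 0 := by
  have hf' : HasFDerivAt f (fderiv ℝ f y) (y + (0 : ℝ) • v) := by simpa using hf.hasFDerivAt
  exact hf'.comp_hasDerivAt 0 (hasDerivAt_add_smul y v 0)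

lemma hasDerivAt_hv_line (y : Base) {i j : Fin 3} (hij : i ≠ j) (m k : Fin 3) :
    HasDerivAt (fun t : ℝ => hv (y + t • eH i j hij) m k) (if m = i ∧ k = j then 1 else 0) 0 := by
  simp only [hv_add_eH]
  split_ifs
  · simpa using (hasDerivAt_id (0 : ℝ)).const_add (hv y m k)
  · simpa using hasDerivAt_const (0 : ℝ) (hv y m k)

section
variable {M : Set Base} {V : PointField (Fin 3) Dep} (hM : IsOpen M)
  (hV : IsInfinitesimalGenerator system M V) {y : Base} (hyM : y ∈ M) (hy : y ∈ guichardSet)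
include hM hV hyM hy

lemma hasDerivAt_fderiv_xi_eH (i k : Fin 3) {a b : Fin 3} (hab : a ≠ b) :
    HasDerivAt (fun t : ℝ => fderiv ℝ (xi V i) (y + t • eH a b hab) (eX k)) 0 0 := by
  simpa using hasDerivAt_fderiv_line_of_isTangent hM (contDiffOn_xi hV i) hyM hy
    (fun z hzM hz => fderiv_xi_eH hV hzM hz i a b hab) (isTangent_eX y k) 0

omit hy in
lemma differentiableAt_phi {i j : Fin 3} (hij : i ≠ j) : DifferentiableAt ℝ (phi V i j hij) y :=
  ((contDiffOn_phi hV i j hij).contDiffAt (hM.mem_nhds hyM)).differentiableAt (by simp)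

omit hy in
lemma differentiableAt_eta (i : Fin 3) : DifferentiableAt ℝ (eta V i) y :=
  ((contDiffOn_eta hV i).contDiffAt (hM.mem_nhds hyM)).differentiableAt (by simp)

/-- The criterion for `h_{ij,k} = h_{ik} h_{kj}`, differentiated with respect to `h_{kj}`. -/
lemma phi_relation {i j k : Fin 3} (hij : i ≠ j) (hik : i ≠ k) (hjk : j ≠ k) :
    hv y i k * fderiv ℝ (phi V i j hij) y (eH i j hij)
      = hv y i k * fderiv ℝ (xi V k) y (eX k) + phi V i k hik y
        + hv y i k * fderiv ℝ (phi V k j hjk.symm) y (eH k j hjk.symm) := by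
  have h0 : ∀ z ∈ M, z ∈ guichardSet →
      fderiv ℝ (phi V i j hij) z (horVec i j k z + ((hv z i k * hv z k j) • eH i j hij
        + (hv z j k * hv z k i) • eH j i hij.symm))
      = fderiv ℝ (xi V k) z (eX k) * (hv z i k * hv z k j)
        + (phi V i k hik z * hv z k j + hv z i k * phi V k j hjk.symm z) := by
    intro z hzM hz
    rw [← map_solVec (fun a hak => fderiv_phi_eH hM hV hzM hz hij hik hjk hak) z 0 0 hij hik hjk]
    exact prolong_h_third hM hV hzM hz hij hik hjk (by simp) (by simp)
  have hL := hasDerivAt_fderiv_line_of_isTangent hM (contDiffOn_phi hV i j hij) hyM hy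
    (v := eH k j hjk.symm) (fun z hzM hz => (fderiv_phi_eH hM hV hzM hz hij hik hjk hjk).2)
    ((isTangent_horVec hy i j k).add (((isTangent_eH y hij).smul (hv y i k * hv y k j)).add
      ((isTangent_eH y hij.symm).smul (hv y j k * hv y k i)))) (hv y i k • eH i j hij)
  have hR := ((hasDerivAt_fderiv_xi_eH hM hV hyM hy k k hjk.symm).mul
      ((hasDerivAt_hv_line y hjk.symm i k).mul (hasDerivAt_hv_line y hjk.symm k j))).add
    (((hasDerivAt_line (differentiableAt_phi hM hV hyM hik) (eH k j hjk.symm)).mul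
      (hasDerivAt_hv_line y hjk.symm k j)).add ((hasDerivAt_hv_line y hjk.symm i k).mul
      (hasDerivAt_line (differentiableAt_phi hM hV hyM hjk.symm) (eH k j hjk.symm))))
  have := deriv_line_unique hM hyM hy (lv_eH hjk.symm) h0 (hL.congr_of_eventuallyEq
    (Eventually.of_forall fun t => ?_)) hR
  · simp [hik, (fderiv_phi_eH hM hV hyM hy hik hij hjk.symm hjk.symm).1] at this
    linear_combination this
  · refine congrArg (fderiv ℝ (phi V i j hij) (y + t • eH k j hjk.symm)) ?_
    simp [horVec, rot_add_eH, hv_add_eH, hij, hik, hjk]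
    module

lemma hasDerivAt_fderiv_phi_eH {i j : Fin 3} (hij : i ≠ j)
    {v : Base} (hv : ∀ z ∈ M, z ∈ guichardSet → fderiv ℝ (phi V i j hij) z v = 0) :
    HasDerivAt (fun t : ℝ => fderiv ℝ (phi V i j hij) (y + t • v) (eH i j hij)) 0 0 := by
  simpa using hasDerivAt_fderiv_line_of_isTangent hM (contDiffOn_phi hV i j hij) hyM hy
    hv (isTangent_eH y hij) 0

/-- The relation `phi_relation`, differentiated with respect to `h_{ik}`. -/
lemma fderiv_phi_relation {i j k : Fin 3} (hij : i ≠ j) (hik : i ≠ k) (hjk : j ≠ k) :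
    fderiv ℝ (phi V i j hij) y (eH i j hij)
      = fderiv ℝ (xi V k) y (eX k) + fderiv ℝ (phi V i k hik) y (eH i k hik)
        + fderiv ℝ (phi V k j hjk.symm) y (eH k j hjk.symm) := by
  have h1 := hasDerivAt_hv_line y hik i k
  have := deriv_line_unique hM hyM hy (lv_eH hik)
    (fun z hzM hz => phi_relation hM hV hzM hz hij hik hjk)
    (h1.mul (hasDerivAt_fderiv_phi_eH hM hV hyM hy hij
      fun z hzM hz => (fderiv_phi_eH hM hV hzM hz hij hik hjk hik).1))
    (((h1.mul (hasDerivAt_fderiv_xi_eH hM hV hyM hy k k hik)).add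
      (hasDerivAt_line (differentiableAt_phi hM hV hyM hik) (eH i k hik))).add
      (h1.mul (hasDerivAt_fderiv_phi_eH hM hV hyM hy hjk.symm
      fun z hzM hz => (fderiv_phi_eH hM hV hzM hz hjk.symm hik.symm hij.symm hik.symm).2)))
  simpa using this

/-- The relations `c_{ij} = a + c_{ik} + c_{kj}` between the symmetric numbers
`c_{ij} = ∂φ^{ij}/∂h_{ij}` force `c_{ij} = -a`, and `phi_relation` becomes `φ^{ik} = -a h_{ik}`. -/
lemma phi_eq {i k : Fin 3} (hik : i ≠ k) (r : Fin 3) :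
    phi V i k hik y = -fderiv ℝ (xi V r) y (eX r) * hv y i k := by
  obtain ⟨j, hij, hkj⟩ := exists_third_index hik
  have ha (m : Fin 3) : fderiv ℝ (xi V m) y (eX m) = fderiv ℝ (xi V r) y (eX r) := by
    by_cases h : m = r
    · rw [h]
    · exact (fderiv_xi_eX_and_phi_eH_symm hM hV hyM hy h).1
  have h0 := phi_relation hM hV hyM hy hij hik hkj.symm
  have h1 := fderiv_phi_relation hM hV hyM hy hij hik hkj.symm
  have h2 := fderiv_phi_relation hM hV hyM hy hkj hik.symm hij.symm
  have s1 := (fderiv_xi_eX_and_phi_eH_symm hM hV hyM hy hik).2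
  rw [ha] at h0 h1 h2
  rw [(fderiv_xi_eX_and_phi_eH_symm hM hV hyM hy hik.symm).2] at h2
  linear_combination -h0 + hv y i k * (h1 - (h1 + h2) / 2)

lemma fderiv_eta_solVec_of_ne {i j : Fin 3} (hij : i ≠ j) {σ τ : Fin 3 → Fin 3 → ℝ}
    (hσ : ∀ i j, σ j i = -σ i j) (hτ : ∀ i j, τ j i = -τ i j) :
    fderiv ℝ (eta V i) y (solVec y σ τ j) = hv y i j * eta V j y := by
  have := prolong_B hV hyM hy hσ hτ hij
  rw [prolongAt_eq hM hV hyM hy, jetCoeff_l_of_ne y _ _ hij, phi_eq hM hV hyM hy hij j] at this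
  unfold eta at this ⊢
  linear_combination this

lemma fderiv_eta_solVec_self {i j k : Fin 3} (hij : i ≠ j) (hik : i ≠ k) (hjk : j ≠ k)
    {σ τ : Fin 3 → Fin 3 → ℝ}
    (hσ : ∀ i j, σ j i = -σ i j) (hτ : ∀ i j, τ j i = -τ i j) :
    fderiv ℝ (eta V i) y (solVec y σ τ i)
      = -(ε i * (ε j * hv y j i * eta V j y + ε k * hv y k i * eta V k y)) := by
  have := prolong_C hV hyM hy hσ hτ hij hik hjk
  rw [prolongAt_eq hM hV hyM hy, jetCoeff_l_self y _ _ hij hik hjk,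
    phi_eq hM hV hyM hy hij.symm i, phi_eq hM hV hyM hy hik.symm i] at this
  unfold eta at this ⊢
  apply mul_left_cancel₀ (ε_ne_zero i)
  linear_combination this + (ε j * hv y j i * V.φ y (lIdx j) + ε k * hv y k i * V.φ y (lIdx k)
    - fderiv ℝ (xi V i) y (eX i) * (ε j * hv y j i * lv y j + ε k * hv y k i * lv y k))
      * ε_mul_self i

lemma fderiv_eta_eH (i a b : Fin 3) (hab : a ≠ b) : fderiv ℝ (eta V i) y (eH a b hab) = 0 := by
  by_cases hib : i = b
  · subst hib
    obtain ⟨k, hik, hak⟩ := exists_third_index hab.symm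
    exact (map_eH_eq_zero (fun σ τ hσ hτ =>
      fderiv_eta_solVec_self hM hV hyM hy hab.symm hik hak hσ hτ) hab).1
  · exact (map_eH_eq_zero (fun σ τ hσ hτ =>
      fderiv_eta_solVec_of_ne hM hV hyM hy hib hσ hτ) hab).1

lemma fderiv_eta_horVec {i j k : Fin 3} (hij : i ≠ j) (hik : i ≠ k) (hjk : j ≠ k) :
    fderiv ℝ (eta V i) y (horVec i k j y) = hv y i j * eta V j y := by
  have := fderiv_eta_solVec_of_ne hM hV hyM hy hij (σ := 0) (τ := 0) (by simp) (by simp)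
  rw [map_solVec (fun a hak => ⟨fderiv_eta_eH hM hV hyM hy i _ _ _,
    fderiv_eta_eH hM hV hyM hy i _ _ _⟩) y 0 0 hik hij hjk.symm] at this
  simpa [fderiv_eta_eH hM hV hyM hy] using this

lemma hasDerivAt_fderiv_eta_horVec {i a b c d e : Fin 3} (hab : a ≠ b) (u : Base)
    (hu : ∀ t : ℝ, horVec c d e (y + t • eH a b hab) = horVec c d e y + t • u) :
    HasDerivAt (fun t : ℝ => fderiv ℝ (eta V i) (y + t • eH a b hab)
      (horVec c d e (y + t • eH a b hab))) (fderiv ℝ (eta V i) y u) 0 := by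
  simp only [hu]
  exact hasDerivAt_fderiv_line_of_isTangent hM (contDiffOn_eta hV i) hyM hy
    (fun z hzM hz => fderiv_eta_eH hM hV hzM hz i _ _ _) (isTangent_horVec hy c d e) u

lemma fderiv_eta_rot_self {i j : Fin 3} (hij : i ≠ j) :
    fderiv ℝ (eta V i) y (rot i j y) = eta V j y := by
  obtain ⟨k, hik, hjk⟩ := exists_third_index hij
  have := deriv_line_unique hM hyM hy (lv_eH hij)
    (fun z hzM hz => fderiv_eta_horVec hM hV hzM hz hij hik hjk)
    (hasDerivAt_fderiv_eta_horVec hM hV hyM hy hij (rot i j y) fun t => by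
      simp [horVec, rot_add_eH, hv_add_eH, hik.symm]; module)
    ((hasDerivAt_hv_line y hij i j).mul
      (hasDerivAt_line (differentiableAt_eta hM hV hyM j) (eH i j hij)))
  simpa [fderiv_eta_eH hM hV hyM hy] using this

lemma fderiv_eta_rot_third {i j k : Fin 3} (hij : i ≠ j) (hik : i ≠ k) (hjk : j ≠ k) :
    fderiv ℝ (eta V i) y (rot k j y) = 0 := by
  have := deriv_line_unique hM hyM hy (lv_eH hjk.symm)
    (fun z hzM hz => fderiv_eta_horVec hM hV hzM hz hij hik hjk)
    (hasDerivAt_fderiv_eta_horVec hM hV hyM hy hjk.symm (rot k j y) fun t => by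
      simp [horVec, rot_add_eH, hv_add_eH, hik]; module)
    ((hasDerivAt_hv_line y hjk.symm i j).mul
      (hasDerivAt_line (differentiableAt_eta hM hV hyM j) (eH k j hjk.symm)))
  simpa [fderiv_eta_eH hM hV hyM hy, hik] using this

/-- On the cone, `η` is equivariant under the infinitesimal rotations. -/
lemma fderiv_eta_rot {m k : Fin 3} (hmk : m ≠ k) (i : Fin 3) :
    fderiv ℝ (eta V i) y (rot m k y)
      = (if i = m then eta V k y else 0) - (if i = k then ε k * ε m * eta V m y else 0) := by
  by_cases him : i = m
  · subst him
    simp [fderiv_eta_rot_self hM hV hyM hy hmk, hmk]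
  · by_cases hik : i = k
    · subst hik
      rw [rot_symm i m, map_smul, fderiv_eta_rot_self hM hV hyM hy hmk.symm]
      simp [him]
      exact Or.inl (mul_comm _ _)
    · simp [him, hik, fderiv_eta_rot_third hM hV hyM hy hik him hmk.symm]

lemma fderiv_eta_eX (i k : Fin 3) : fderiv ℝ (eta V i) y (eX k) = 0 := by
  by_cases hik : i = k
  · subst hik
    obtain ⟨j, k, hij, hik, hjk⟩ : ∃ j k : Fin 3, i ≠ j ∧ i ≠ k ∧ j ≠ k := by revert i; decide
    have h := fderiv_eta_solVec_self hM hV hyM hy hij hik hjk (σ := 0) (τ := 0) (by simp) (by simp)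
    rw [map_solVec (fun a hak => ⟨fderiv_eta_eH hM hV hyM hy i _ _ _,
      fderiv_eta_eH hM hV hyM hy i _ _ _⟩) y 0 0 hjk hij.symm hik.symm] at h
    simp [horVec, fderiv_eta_eH hM hV hyM hy, fderiv_eta_rot hM hV hyM hy, hij.symm, hik.symm,
      hij, hik] at h
    linear_combination h
  · obtain ⟨j, hij, hkj⟩ := exists_third_index hik
    have h := fderiv_eta_horVec hM hV hyM hy hik hij hkj
    simp [horVec, fderiv_eta_rot hM hV hyM hy, hij, hik, hkj.symm] at h
    linear_combination h

end

/-! ### Integration along the cone -/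

/-- The derivative along the path may fail to vanish at the final point `γ b`. -/
lemma eq_of_hasDerivAt_path {M : Set Base} {f : Base → ℝ} (hf : ∀ y ∈ M, DifferentiableAt ℝ f y)
    {γ γ' : ℝ → Base} {a b : ℝ} (hab : a ≤ b) (hγM : ∀ t ∈ Set.Icc a b, γ t ∈ M)
    (hγ : ∀ t ∈ Set.Icc a b, HasDerivAt γ (γ' t) t)
    (h0 : ∀ t ∈ Set.Ico a b, fderiv ℝ f (γ t) (γ' t) = 0) : f (γ b) = f (γ a) := by
  have h1 : ∀ t ∈ Set.Icc a b, HasDerivAt (f ∘ γ) (fderiv ℝ f (γ t) (γ' t)) t := fun t ht =>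
    (hf _ (hγM t ht)).hasFDerivAt.comp_hasDerivAt t (hγ t ht)
  refine constant_of_has_deriv_right_zero (f := f ∘ γ)
    (fun t ht => (h1 t ht).continuousAt.continuousWithinAt) (fun t ht => ?_) b ⟨hab, le_rfl⟩
  rw [← h0 t ht]
  exact (h1 t ⟨ht.1, ht.2.le⟩).hasDerivWithinAt

/-- The function `f` is differentiable on `M`, and its derivatives tangent to the cone vanish. -/
def ConstAlongCone (M : Set Base) (f : Base → ℝ) : Prop :=
  ∀ y ∈ M, DifferentiableAt ℝ f y ∧
    (y ∈ guichardSet → ∀ w, IsTangent y w → fderiv ℝ f y w = 0)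

lemma ConstAlongCone.of_basis {M : Set Base} {f : Base → ℝ}
    (hf : ∀ y ∈ M, DifferentiableAt ℝ f y)
    (hX : ∀ y ∈ M, y ∈ guichardSet → ∀ k, fderiv ℝ f y (eX k) = 0)
    (hH : ∀ y ∈ M, y ∈ guichardSet → ∀ i j (hij : i ≠ j), fderiv ℝ f y (eH i j hij) = 0)
    (hR : ∀ y ∈ M, y ∈ guichardSet → ∀ m k, m ≠ k → fderiv ℝ f y (rot m k y) = 0) :
    ConstAlongCone M f := fun y hyM =>
  ⟨hf y hyM, fun hy _ hw => map_eq_zero_of_isTangent (hX y hyM hy) (hH y hyM hy) (hR y hyM hy) hw⟩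

lemma lv_sub (y z : Base) (i : Fin 3) : lv (y - z) i = lv y i - lv z i := rfl

lemma segment_mem_guichardSet {y z : Base} (hy : y ∈ guichardSet) 
    (hz0 : ∀ i, lv z i = 0) (t : ℝ) : z + t • (y - z) ∈ guichardSet := by
  rw [mem_guichardSet] at *
  simp only [lv_line, lv_sub, hz0, sub_zero, zero_add]
  linear_combination t ^ 2 * hy

/-- Near a vertex, points of the cone are joined to the vertex by a segment in the cone; elsewhere the
cone is locally a graph over a convex set. -/
lemma ConstAlongCone.eventually_eq {M : Set Base} (hM : IsOpen M) {f : Base → ℝ}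
    (hf : ConstAlongCone M f) {y₀ : Base} (hyM : y₀ ∈ M) (hy : y₀ ∈ guichardSet) :
    ∀ᶠ y in 𝓝 y₀, y ∈ guichardSet → f y = f y₀ := by
  by_cases h1 : lv y₀ 1 = 0
  · obtain ⟨r, hr, hball⟩ := Metric.isOpen_iff.1 hM y₀ hyM
    filter_upwards [Metric.ball_mem_nhds y₀ hr] with y hyr hyC
    have hz0 := lv_eq_zero hy h1
    have hmem : ∀ t ∈ Set.Icc (0 : ℝ) 1, y + t • (y₀ - y) ∈ M := fun t ht =>
      hball ((convex_ball y₀ r).add_smul_sub_mem hyr (Metric.mem_ball_self hr) ht)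
    have hcone (t : ℝ) : y + t • (y₀ - y) ∈ guichardSet := by
      have := segment_mem_guichardSet hyC hz0 (1 - t)
      convert this using 1
      module
    have := eq_of_hasDerivAt_path (fun y hy => (hf y hy).1) zero_le_one hmem
      (fun t _ => hasDerivAt_add_smul y (y₀ - y) t) fun t ht =>
        (hf _ (hmem t ⟨ht.1, ht.2.le⟩)).2 (hcone t) _ ?_
    · simpa using this.symm
    · rw [mem_guichardSet] at hyC
      refine ⟨?_, fun h i => ?_⟩ <;> simp only [lv_line, lv_sub, hz0] at *
      · linear_combination -(1 - t) * hyC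
      · have hy1 : lv y 1 = 0 := by
          have : (1 - t) * lv y 1 = 0 := by linear_combination h
          exact (mul_eq_zero.1 this).resolve_left (by linarith [ht.2])
        rw [lv_eq_zero (mem_guichardSet.2 hyC) hy1, sub_zero]
  · obtain ⟨s, hs, hpos⟩ := exists_sign h1
    have hself := graphMap_eq_self hs hy hpos.le
    have c0 := continuous_lv 0
    have c1 := continuous_lv 1
    have c2 := continuous_lv 2
    have hU : {y | graphMap s y ∈ M} ∩ {y | lv y 0 ^ 2 + lv y 2 ^ 2 ≠ 0} ∩ {y | 0 < s * lv y 1}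
        ∈ 𝓝 y₀ := by
      refine inter_mem (inter_mem ?_ ?_) ?_
      · exact ((continuous_graphMap s).isOpen_preimage _ hM).mem_nhds (by simpa [hself] using hyM)
      · refine (isOpen_ne_fun (by fun_prop) (by fun_prop)).mem_nhds ?_
        change lv y₀ 0 ^ 2 + lv y₀ 2 ^ 2 ≠ 0
        rw [← mem_guichardSet.1 hy]; positivity
      · exact (isOpen_lt (by fun_prop) (by fun_prop)).mem_nhds hpos
    obtain ⟨r, hr, hball⟩ := Metric.mem_nhds_iff.1 hU
    filter_upwards [Metric.ball_mem_nhds y₀ hr] with y hyr hyC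
    have hmem : ∀ t ∈ Set.Icc (0 : ℝ) 1, y₀ + t • (y - y₀) ∈ Metric.ball y₀ r := fun t ht =>
      (convex_ball y₀ r).add_smul_sub_mem (Metric.mem_ball_self hr) hyr ht
    have := eq_of_hasDerivAt_path (fun y hy => (hf y hy).1) zero_le_one
      (fun t ht => (hball (hmem t ht)).1.1)
      (fun t ht => hasDerivAt_graphMap (s := s) (hball (hmem t ht)).1.2)
      (fun t ht => (hf _ (hball (hmem t ⟨ht.1, ht.2.le⟩)).1.1).2 (graphMap_mem hs _) _
        (isTangent_deriv_graphMap hs (hball (hmem t ⟨ht.1, ht.2.le⟩)).1.2))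
    simpa [hself, graphMap_eq_self hs hyC (hball hyr).2.le] using this

/-- Constants that exist locally and are locally unique glue over a preconnected set. -/
lemma exists_forall_of_eventually {S : Set Base} (hS : IsPreconnected S) {P : ℝ → Base → Prop}
    (hex : ∀ y₀ ∈ S, ∃ c, ∀ᶠ y in 𝓝 y₀, y ∈ S → P c y)
    (huniq : ∀ y₀ ∈ S, ∀ c c', (∀ᶠ y in 𝓝 y₀, y ∈ S → P c y) →
      (∀ᶠ y in 𝓝 y₀, y ∈ S → P c' y) → c = c') : ∃ c, ∀ y ∈ S, P c y := by
  rcases S.eq_empty_or_nonempty with rfl | ⟨y₁, hy₁⟩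
  · exact ⟨0, by simp⟩
  have : PreconnectedSpace S := Subtype.preconnectedSpace hS
  choose! c hc using hex
  have hloc : IsLocallyConstant fun y : S => c y := by
    rw [IsLocallyConstant.iff_eventually_eq]
    intro y₀
    have h2 := (continuous_subtype_val.tendsto y₀).eventually (hc y₀ y₀.2).eventually_nhds
    filter_upwards [h2] with y hy
    exact huniq y y.2 _ _ (hc y y.2) hy
  refine ⟨c y₁, fun y hy => ?_⟩
  have h3 : c y = c y₁ := hloc.apply_eq_of_preconnectedSpace ⟨y, hy⟩ ⟨y₁, hy₁⟩
  rw [← h3]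
  exact (hc y hy).self_of_nhds hy

lemma ConstAlongCone.exists_eq {M : Set Base} (hM : IsOpen M)
    (hconn : IsPreconnected (M ∩ guichardSet)) {f : Base → ℝ}
    (hf : ConstAlongCone M f) : ∃ c, ∀ y ∈ M ∩ guichardSet, f y = c :=
  exists_forall_of_eventually hconn
    (fun y₀ hy₀ => ⟨f y₀, (hf.eventually_eq hM hy₀.1 hy₀.2).mono fun _ h hy => h hy.2⟩)
    fun _ hy₀ _ _ h h' => (h.self_of_nhds hy₀).symm.trans (h'.self_of_nhds hy₀)

section
variable {M : Set Base} {V : PointField (Fin 3) Dep} (hM : IsOpen M)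
  (hV : IsInfinitesimalGenerator system M V)
include hM hV

lemma fderiv_xi_eX_eq {y : Base} (hyM : y ∈ M) (hy : y ∈ guichardSet) (i j : Fin 3) :
    fderiv ℝ (xi V i) y (eX i) = fderiv ℝ (xi V j) y (eX j) := by
  by_cases h : i = j
  · rw [h]
  · exact (fderiv_xi_eX_and_phi_eH_symm hM hV hyM hy h).1

omit hM hV in
lemma lv_eX (k i : Fin 3) : lv (eX k) i = 0 := rfl

/-- For the direction `x_0` itself one uses that `∂ξ^0/∂x_0 = ∂ξ^1/∂x_1` on the cone, and that
`∂ξ^1/∂x_0` vanishes there. -/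
lemma constAlongCone_fderiv_xi : ConstAlongCone M fun y => fderiv ℝ (xi V 0) y (eX 0) := by
  have hsymm {y : Base} (hyM : y ∈ M) (v w : Base) :
      fderiv ℝ (fun z => fderiv ℝ (xi V 0) z v) y w
        = fderiv ℝ (fun z => fderiv ℝ (xi V 0) z w) y v :=
    (hasDerivAt_fderiv_line hM (contDiffOn_xi hV 0) hyM v w).unique
      (hasDerivAt_line (differentiableAt_fderiv_apply hM (contDiffOn_xi hV 0) hyM w) v)
  have hdiff {y : Base} (hyM : y ∈ M) (w : Base) :=
    differentiableAt_fderiv_apply hM (contDiffOn_xi hV 0) hyM w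
  refine .of_basis (fun y hyM => hdiff hyM _) (fun y hyM hy k => ?_)
    (fun y hyM hy i j hij => ?_) (fun y hyM hy m k hmk => ?_)
  · by_cases hk : 0 = k
    · subst hk
      refine deriv_line_unique hM hyM hy (lv_eX 0)
        (fun z hzM hz => fderiv_xi_eX_eq hM hV hzM hz 0 1) (hasDerivAt_line (hdiff hyM _) _) ?_
      simpa using hasDerivAt_fderiv_line_of_isTangent hM (contDiffOn_xi hV 1) hyM hy
        (fun z hzM hz => fderiv_xi_eX hM hV hzM hz (by decide)) (isTangent_eX y 1) 0
    · rw [hsymm hyM]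
      exact fderiv_eq_zero_of_isTangent hM hyM hy (hdiff hyM _)
        (fun z hzM hz => fderiv_xi_eX hM hV hzM hz hk) (isTangent_eX y 0)
  · rw [hsymm hyM]
    exact fderiv_eq_zero_of_isTangent hM hyM hy (hdiff hyM _)
      (fun z hzM hz => fderiv_xi_eH hV hzM hz 0 i j hij) (isTangent_eX y 0)
  · rw [hsymm hyM]
    refine deriv_line_unique hM hyM hy (lv_eX 0)
      (g := fun _ => 0) (f := fun z => fderiv ℝ (xi V 0) z (rot m k z))
      (fun z hzM hz => fderiv_xi_rot hM hV hzM hz 0 m k hmk) ?_ (hasDerivAt_const _ _)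
    have hrot (t : ℝ) : rot m k (y + t • eX 0) = rot m k y := by
      simp [rot, lv_line, lv_eX]
    simp only [hrot]
    exact hasDerivAt_line (hdiff hyM (rot m k y)) (eX 0)

lemma exists_xi_eq (hconn : IsPreconnected (M ∩ guichardSet)) :
    ∃ (a : ℝ) (b : Fin 3 → ℝ), (∀ y ∈ M ∩ guichardSet, fderiv ℝ (xi V 0) y (eX 0) = a) ∧
      ∀ y ∈ M ∩ guichardSet, ∀ i, xi V i y = a * y.1 i + b i := by
  obtain ⟨a, ha⟩ := (constAlongCone_fderiv_xi hM hV).exists_eq hM hconn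
  have hb (i : Fin 3) : ∃ b, ∀ y ∈ M ∩ guichardSet, xi V i y - a * y.1 i = b := by
    have hdx (y : Base) (hyM : y ∈ M) : DifferentiableAt ℝ (xi V i) y :=
      ((contDiffOn_xi hV i).contDiffAt (hM.mem_nhds hyM)).differentiableAt (by simp)
    let p : Base →L[ℝ] ℝ := a • (ContinuousLinearMap.proj (R := ℝ) (φ := fun _ : Fin 3 => ℝ) i).comp
      (ContinuousLinearMap.fst ℝ (Fin 3 → ℝ) (Dep → ℝ))
    have hd (y : Base) (hyM : y ∈ M) (w : Base) :
        fderiv ℝ (fun y => xi V i y - a * y.1 i) y w = fderiv ℝ (xi V i) y w - a * w.1 i := by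
      rw [((hdx y hyM).hasFDerivAt.fun_sub (g := fun y => a * y.1 i) p.hasFDerivAt).fderiv]
      simp [p]
    refine ConstAlongCone.exists_eq hM hconn (.of_basis
      (fun y hyM => (hdx y hyM).sub (g := fun y => a * y.1 i) p.differentiableAt)
      (fun y hyM hy k => ?_) (fun y hyM hy m k hmk => ?_) (fun y hyM hy m k hmk => ?_))
    · rw [hd y hyM]
      by_cases hik : i = k
      · subst hik
        rw [fderiv_xi_eX_eq hM hV hyM hy i 0, ha y ⟨hyM, hy⟩]
        simp [eX]
      · rw [fderiv_xi_eX hM hV hyM hy hik]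
        simp [eX, hik]
    · rw [hd y hyM, fderiv_xi_eH hV hyM hy]
      simp [eH]
    · rw [hd y hyM, fderiv_xi_rot hM hV hyM hy i m k hmk]
      simp [rot, eL]
  choose b hb using hb
  exact ⟨a, b, ha, fun y hy i => by rw [← hb i y hy]; ring⟩

/-- On the cone, `η` is parallel to `l`: the rotation with axis `l` fixes `l`, hence annihilates `η`
by equivariance. -/
lemma lv_mul_eta {y : Base} (hyM : y ∈ M) (hy : y ∈ guichardSet) (i : Fin 3) :
    lv y 1 * eta V i y = lv y i * eta V 1 y := by
  have h01 := fun i => fderiv_eta_rot hM hV hyM hy (m := 0) (k := 1) (by decide) i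
  have h02 := fun i => fderiv_eta_rot hM hV hyM hy (m := 0) (k := 2) (by decide) i
  have h12 := fun i => fderiv_eta_rot hM hV hyM hy (m := 1) (k := 2) (by decide) i
  have key (i : Fin 3) : lv y 2 * fderiv ℝ (eta V i) y (rot 0 1 y)
      - lv y 1 * fderiv ℝ (eta V i) y (rot 0 2 y) - lv y 0 * fderiv ℝ (eta V i) y (rot 1 2 y)
      = 0 := by
    simp [rot, ε]
    ring
  fin_cases i
  · have := key 2
    rw [h01, h02, h12] at this
    simp [ε] at this ⊢
    linarith
  · simp
  · have := key 0
    rw [h01, h02, h12] at this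
    simp at this ⊢
    linarith

lemma eta_eq_zero {y : Base} (hyM : y ∈ M) (hy : y ∈ guichardSet) (h0 : lv y 1 = 0) (i : Fin 3) :
    eta V i y = 0 := by
  obtain ⟨m, hmi, -⟩ := exists_third_index (i := i) (j := i + 1) (by revert i; decide)
  have h := fderiv_eta_rot hM hV hyM hy hmi.symm m
  have hrot : rot m i y = 0 := by simp [rot, lv_eq_zero hy h0]
  simpa [hrot, hmi.symm] using h.symm

/-- Away from the vertices the factor `η^1 / l_1` between `η` and `l` is constant along the cone. -/
lemma constAlongCone_eta_div :
    ConstAlongCone (M ∩ {y | lv y 1 ≠ 0}) fun y => eta V 1 y / lv y 1 := by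
  let q : Base →L[ℝ] ℝ := (ContinuousLinearMap.proj (R := ℝ) (φ := fun _ : Dep => ℝ) (lIdx 1)).comp
      (ContinuousLinearMap.snd ℝ (Fin 3 → ℝ) (Dep → ℝ))
  have hd (y : Base) (hy : y ∈ M ∩ {y | lv y 1 ≠ 0}) :
      HasFDerivAt (fun y => eta V 1 y / lv y 1)
        ((lv y 1 ^ 2)⁻¹ • (lv y 1 • fderiv ℝ (eta V 1) y - eta V 1 y • q)) y := by
    have hinv := (hasDerivAt_inv (x := q y) hy.2).comp_hasFDerivAt y q.hasFDerivAt
    have h := (differentiableAt_eta hM hV hy.1 1).hasFDerivAt.mul hinv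
    have h' : HasFDerivAt (fun y => eta V 1 y / lv y 1) _ y := h
    refine h'.congr_fderiv ?_
    have hne : q y ≠ 0 := hy.2
    ext w
    all_goals
      change _ = (q y ^ 2)⁻¹ * (q y * _ - eta V 1 y * _)
      simp
      field_simp
      ring
  have hq (w : Base) : q w = lv w 1 := rfl
  refine .of_basis (fun y hy => (hd y hy).differentiableAt) (fun y hyM hy k => ?_)
    (fun y hyM hy i j hij => ?_) (fun y hyM hy m k hmk => ?_) <;> rw [(hd y hyM).fderiv]
  · simp [fderiv_eta_eX hM hV hyM.1 hy, hq, lv_eX]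
  · simp [fderiv_eta_eH hM hV hyM.1 hy, hq, lv_eH]
  · simp [fderiv_eta_rot hM hV hyM.1 hy hmk, hq, lv_rot]
    right
    by_cases hm : 1 = m
    · subst hm
      simp [hmk]
      linear_combination lv_mul_eta hM hV hyM.1 hy k
    · simp [hm]
      by_cases hk : 1 = k
      · subst hk
        simp
        linear_combination -ε 1 * ε m * lv_mul_eta hM hV hyM.1 hy m
      · simp [hk]

/-- The two halves of the cone meet in the vertices only, so that the factors between `η` and `l` on the
two halves have to be compared there. On a ray of the cone this factor is the derivative of `η` at
the vertex in the direction of the ray; as null vectors span the space, that derivative is a multiple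
of the identity. -/
lemma eta_eventually_eq_of_vertex {y₀ : Base} (hyM : y₀ ∈ M) (hy₀ : y₀ ∈ guichardSet)
    (h0 : lv y₀ 1 = 0) :
    ∀ᶠ y in 𝓝 y₀, y ∈ guichardSet → ∀ i, eta V i y = fderiv ℝ (eta V 1) y₀ (eL 1) * lv y i := by
  have hz0 := lv_eq_zero hy₀ h0
  obtain ⟨r, hr, hball⟩ := Metric.isOpen_iff.1 hM y₀ hyM
  have hη₀ (i : Fin 3) := (differentiableAt_eta hM hV hyM i)
  -- On each ray, `η` is linear, hence equal to its derivative at the vertex.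
  have key : ∀ y ∈ Metric.ball y₀ r, y ∈ guichardSet → ∃ c, ∀ i,
      eta V i y = c * lv y i ∧ fderiv ℝ (eta V i) y₀ (y - y₀) = c * lv y i := by
    intro y hyr hyC
    have hmem : ∀ t ∈ Set.Icc (0 : ℝ) 1, y₀ + t • (y - y₀) ∈ M := fun t ht =>
      hball ((convex_ball y₀ r).add_smul_sub_mem (Metric.mem_ball_self hr) hyr ht)
    have hcone := segment_mem_guichardSet hyC hz0
    have hlv (t : ℝ) (i : Fin 3) : lv (y₀ + t • (y - y₀)) i = t * lv y i := by
      simp [lv_line, lv_sub, hz0]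
    by_cases hy1 : lv y 1 = 0
    · refine ⟨0, fun i => ⟨?_, ?_⟩⟩
      · rw [eta_eq_zero hM hV (hball hyr) hyC hy1, zero_mul]
      · rw [zero_mul]
        refine map_eq_zero_of_isTangent (fun k => fderiv_eta_eX hM hV hyM hy₀ i k)
          (fun a b hab => fderiv_eta_eH hM hV hyM hy₀ i a b hab) (y := y₀)
          (fun m k _ => by simp [rot, hz0]) (isTangent_of_lv_eq_zero _ fun j => ?_)
        rw [lv_sub, lv_eq_zero hyC hy1, hz0, sub_zero]
    · have hray : ∀ t ∈ Set.Icc (0 : ℝ) 1, ∀ i,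
          eta V i (y₀ + t • (y - y₀)) = eta V 1 y / lv y 1 * (t * lv y i) := by
        intro t ht i
        rcases ht.1.eq_or_lt with rfl | hpos
        · simpa using eta_eq_zero hM hV hyM hy₀ h0 i
        have hne : lv (y₀ + t • (y - y₀)) 1 ≠ 0 := by
          rw [hlv]; exact mul_ne_zero hpos.ne' hy1
        have hIcc : ∀ u ∈ Set.Icc t 1, y₀ + u • (y - y₀) ∈ M ∩ {y | lv y 1 ≠ 0} := fun u hu =>
          ⟨hmem u ⟨hpos.le.trans hu.1, hu.2⟩, by
            change lv _ 1 ≠ 0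
            rw [hlv]; exact mul_ne_zero (hpos.trans_le hu.1).ne' hy1⟩
        have h2 := eq_of_hasDerivAt_path
          (fun y hy => (constAlongCone_eta_div hM hV y hy).1) ht.2 hIcc
          (fun u _ => hasDerivAt_add_smul y₀ (y - y₀) u) fun u hu =>
            (constAlongCone_eta_div hM hV _ (hIcc u ⟨hu.1, hu.2.le⟩)).2 (hcone u) _ ?_
        · simp only [one_smul, add_sub_cancel] at h2
          have h3 := lv_mul_eta hM hV (hmem t ht) (hcone t) i
          rw [h2]
          rw [← hlv t i]
          field_simp
          linear_combination h3
        · refine ⟨?_, fun h => absurd h (hIcc u ⟨hu.1, hu.2.le⟩).2⟩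
          simp only [hlv, lv_sub, hz0, sub_zero]
          linear_combination u * mem_guichardSet.1 hyC
      refine ⟨eta V 1 y / lv y 1, fun i => ⟨?_, ?_⟩⟩
      · simpa using hray 1 (by simp) i
      · have h1 := (hasDerivAt_line (hη₀ i) (y - y₀)).hasDerivWithinAt (s := Set.Icc 0 1)
        have h2 : HasDerivWithinAt (fun t : ℝ => eta V 1 y / lv y 1 * (t * lv y i))
            (eta V 1 y / lv y 1 * lv y i) (Set.Icc 0 1) 0 := by
          simpa using (((hasDerivAt_id (0 : ℝ)).mul_const (lv y i)).const_mul
            (eta V 1 y / lv y 1)).hasDerivWithinAt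
        exact (uniqueDiffOn_Icc zero_lt_one 0 (by simp)).eq_deriv _ h1
          (h2.congr (fun t ht => hray t ht i) (hray 0 (by simp) i))
  -- By homogeneity, the derivative at the vertex maps every null vector to a multiple of it.
  have hlin (v : Base) (hv : v ∈ guichardSet) : ∃ c, ∀ i, fderiv ℝ (eta V i) y₀ v = c * lv v i := by
    have hc : ContinuousAt (fun t : ℝ => y₀ + t • v) 0 := by fun_prop
    obtain ⟨δ, hδ, hδ'⟩ := Metric.mem_nhds_iff.1
      (hc.preimage_mem_nhds (by simpa using Metric.ball_mem_nhds y₀ hr))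
    have hδ2 : δ / 2 ∈ Metric.ball (0 : ℝ) δ := by simp [abs_of_pos hδ, hδ]
    have hδv : y₀ + (δ / 2) • v ∈ guichardSet := by
      rw [mem_guichardSet] at *
      simp only [lv_line, hz0]
      linear_combination (δ / 2) ^ 2 * hv
    obtain ⟨c, hc⟩ := key _ (hδ' hδ2) hδv
    refine ⟨c, fun i => ?_⟩
    have := (hc i).2
    simp only [add_sub_cancel_left, map_smul, lv_line, hz0, smul_eq_mul] at this
    have hδ0 : δ / 2 ≠ 0 := by positivity
    apply mul_left_cancel₀ hδ0
    linear_combination this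
  have hL (i m : Fin 3) : fderiv ℝ (eta V i) y₀ (eL m)
      = if i = m then fderiv ℝ (eta V 1) y₀ (eL 1) else 0 := by
    obtain ⟨c1, h1⟩ := hlin (eL 1 + eL 0) (by simp [mem_guichardSet, lv, eL])
    obtain ⟨c2, h2⟩ := hlin (eL 1 - eL 0) (by simp [mem_guichardSet, lv, eL])
    obtain ⟨c3, h3⟩ := hlin (eL 1 + eL 2) (by simp [mem_guichardSet, lv, eL])
    obtain ⟨c4, h4⟩ := hlin (eL 1 - eL 2) (by simp [mem_guichardSet, lv, eL])
    simp only [Fin.forall_fin_succ, map_add, map_sub] at h1 h2 h3 h4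
    simp [lv, eL] at h1 h2 h3 h4
    fin_cases i <;> fin_cases m <;> simp [eL] <;> linarith
  filter_upwards [Metric.ball_mem_nhds y₀ hr] with y hyr hyC i
  obtain ⟨c, hc⟩ := key y hyr hyC
  have hw : ∀ m, lv (y - y₀) m = lv y m := fun m => by rw [lv_sub, hz0, sub_zero]
  rw [(hc i).1, ← (hc i).2]
  generalize y - y₀ = w at hw
  generalize fderiv ℝ (eta V 1) y₀ (eL 1) = A at hL ⊢
  conv_lhs => rw [eq_sum_basis w]
  simp only [map_add, map_sum, map_smul, fderiv_eta_eX hM hV hyM hy₀, fderiv_eta_eH hM hV hyM hy₀,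
    hL, hw, smul_eq_mul, mul_zero, Finset.sum_const_zero, zero_add, add_zero,
    mul_ite, Finset.sum_ite_eq, Finset.mem_univ, if_true]
  exact mul_comm _ _

lemma exists_eta_eq (hconn : IsPreconnected (M ∩ guichardSet)) :
    ∃ c, ∀ y ∈ M ∩ guichardSet, ∀ i, eta V i y = c * lv y i := by
  refine exists_forall_of_eventually hconn (P := fun c y => ∀ i, eta V i y = c * lv y i) ?_ ?_
  · rintro y₀ ⟨hyM, hy⟩
    by_cases h0 : lv y₀ 1 = 0
    · exact ⟨_, (eta_eventually_eq_of_vertex hM hV hyM hy h0).mono fun _ h hyS => h hyS.2⟩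
    · have hM' : IsOpen {y | lv y 1 ≠ 0} := isOpen_ne_fun (continuous_lv 1) continuous_const
      refine ⟨eta V 1 y₀ / lv y₀ 1, ?_⟩
      filter_upwards [(constAlongCone_eta_div hM hV).eventually_eq (hM.inter hM') ⟨hyM, h0⟩ hy,
        hM'.mem_nhds h0] with y h1 h2 hyS i
      rw [← h1 hyS.2, div_mul_eq_mul_div, eq_div_iff h2]
      linear_combination lv_mul_eta hM hV hyS.1 hyS.2 i
  · -- Uniqueness: every vertex is a limit of points of the cone with `l_1 ≠ 0`.
    rintro y₀ ⟨hyM, hy⟩ c c' h h'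
    have hev := h.and h'
    suffices ∃ y ∈ M ∩ guichardSet, lv y 1 ≠ 0 ∧ (∀ i, eta V i y = c * lv y i) ∧
        ∀ i, eta V i y = c' * lv y i by
      obtain ⟨y, -, hy1, e, e'⟩ := this
      exact mul_right_cancel₀ hy1 ((e 1).symm.trans (e' 1))
    by_cases h0 : lv y₀ 1 = 0
    · have hc : ContinuousAt (fun t : ℝ => y₀ + t • (eL 1 + eL 0)) 0 := by fun_prop
      obtain ⟨δ, hδ, hδ'⟩ := Metric.mem_nhds_iff.1 (hc.preimage_mem_nhds
        (t := {y | (y ∈ M ∩ guichardSet → ∀ i, eta V i y = c * lv y i) ∧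
          (y ∈ M ∩ guichardSet → ∀ i, eta V i y = c' * lv y i)} ∩ M)
        (by simpa using inter_mem hev (hM.mem_nhds hyM)))
      have hδ2 : δ / 2 ∈ Metric.ball (0 : ℝ) δ := by simp [abs_of_pos hδ, hδ]
      obtain ⟨⟨e, e'⟩, hm⟩ := hδ' hδ2
      have hlv (i : Fin 3) : lv (y₀ + (δ / 2) • (eL 1 + eL 0)) i = δ / 2 * lv (eL 1 + eL 0) i := by
        rw [lv_line, lv_eq_zero hy h0, zero_add]
      have hC : y₀ + (δ / 2) • (eL 1 + eL 0) ∈ guichardSet := by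
        rw [mem_guichardSet, hlv, hlv, hlv]
        simp [lv, eL]
      refine ⟨_, ⟨hm, hC⟩, ?_, e ⟨hm, hC⟩, e' ⟨hm, hC⟩⟩
      rw [hlv]
      simp [lv, eL, hδ.ne']
    · exact ⟨y₀, ⟨hyM, hy⟩, h0, h.self_of_nhds ⟨hyM, hy⟩, h'.self_of_nhds ⟨hyM, hy⟩⟩

end

end Lame


theorem theorem3p1 (M : Set Lame.Base) (hM : IsOpen M)
    (hconn : IsPreconnected (M ∩ Lame.guichardSet))
    (V : PointField (Fin 3) Lame.Dep) (hV : IsInfinitesimalGenerator Lame.system M V) :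
    ∃ (a c : ℝ) (b : Fin 3 → ℝ), ∀ y ∈ M ∩ Lame.guichardSet,
      (∀ i, V.ξ y i = a * y.1 i + b i) ∧
      (∀ i, V.φ y (Lame.lIdx i) = c * y.2 (Lame.lIdx i)) ∧
      (∀ (i j : Fin 3) (hij : i ≠ j),
        V.φ y (Lame.hIdx i j hij) = -a * y.2 (Lame.hIdx i j hij)) := by
  obtain ⟨a, b, ha, hξ⟩ := Lame.exists_xi_eq hM hV hconn
  obtain ⟨c, hη⟩ := Lame.exists_eta_eq hM hV hconn
  refine ⟨a, c, b, fun y hy => ⟨hξ y hy, hη y hy, fun i j hij => ?_⟩⟩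
  rw [← Lame.hv_of_ne y hij, ← ha y hy]
  exact Lame.phi_eq hM hV hy.1 hy.2 hij 0
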